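/- **Setting.** Let $(\Omega,\mathcal A,\mathbb P)$ be a probability space, $p\in[1,\infty)$, $\beta\in(0,1)$. Positive values of random variables are losses. Let $(Y,Z)$ be the representative of the i.i.d. disturbances $(Y_n,Z_n)_{n\ge1}$ of a stationary model, with claims $Y\in L^p$, $Y\ge0$, and premium income $Z\in L^\infty$, $Z\ge0$. Let $\rho:L^p\to[-\infty,\infty]$ be a law-invariant, proper, coherent (monotone, translation invariant, positive homogeneous, subadditive) risk measure with the Fatou property: $\rho(X)\le\liminf_n\rho(X_n)$ whenever $X_n\to X$ a.s. and $|X_n|\le W$ a.s. for some $W\in L^p$ ($X_n,X\in L^p$). Let $\pi_R:L^p_+\to[-\infty,\infty]$ be a law-invariant, monotone premium principle with $\pi_R(0)=0$ and the Fatou property. Assume $\rho(Y)<\infty$ and $\pi_R(Y)<\infty$. Let $\mathcal F$ be the set of $f:\mathbb R_+\to\mathbb R_+$ with $f(t)\le t$ for all $t$ such that $f$ and $\mathrm{id}-f$ are increasing, with the Borel $\sigma$-algebra of the topology of compact convergence, and write $\pi_R(f)=\pi_R(Y-f(Y))$. The admissible sets are either $D(x)=\mathcal F$ for all $x\in\mathbb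 R$ (unconstrained case) or $D(x)=\{f\in\mathcal F:\pi_R(f)\le x^+\}$ for all $x\in\mathbb R$ (budget-constrained case). A Markov decision rule is a measurable map $d:\mathbb R\to\mathcal F$ with $d(x)\in D(x)$ for all $x$; a Markov policy is a sequence $\pi=(d_0,d_1,\dots)$ of Markov decision rules, and $\Pi^M$ is the set of all Markov policies. For $v:\mathbb R\to\mathbb R$ put $$Lv(x,f)=\rho\Big(f(Y)+\pi_R(f)-Z-x+\beta\,v\big(x+Z-f(Y)-\pi_R(f)\big)\Big),$$ $$\mathcal T_dv(x)=Lv(x,d(x)),\qquad \mathcal Tv(x)=\inf_{f\in D(x)}Lv(x,f).$$ For $\pi=(d_0,d_1,\dots)\in\Pi^M$ let $$J_{N\pi}=\mathcal T_{d_0}\cdots\mathcal T_{d_{N-1}}0,\quad J_N=\inf_{\pi\in\Pi^M}J_{N\pi},\quad J=\lim_{N\to\infty}J_N,\quad J_{\infty\pi}=\lim_{N\to\infty}J_{N\pi},\quad J_\infty=\inf_{\pi\in\Pi^M}J_{\infty\pi}$$ (all pointwise). Let $\eta=\rho(Y)+\pi_R(Y)+\operatorname{ess\,sup}Z$ and $b(x)=\frac{|x|}{1-\beta}+\frac{\eta}{(1-\beta)^2}$.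 Let $\mathbb B$ be the set of decreasing, lower semicontinuous $v:\mathbb R\to\mathbb R$ with $|v|\le\lambda b$ for some $\lambda\ge0$, and let $\|v\|_b=\sup_{x\in\mathbb R}|v(x)|/b(x)$ (with $0/0=0$). **Theorem.** All these objects are well defined: $\rho$ is applied to elements of $L^p$ and takes finite values there whenever $f\in D(x)$ and $v\in\mathbb B$ or $v=J_{N\pi}$ for some $N\in\mathbb N_0$, $\pi\in\Pi^M$ (in the latter case, for $f=d(x)$ with any Markov decision rule $d$); the infima are finite; and the limits exist in $\mathbb R$. Moreover: 1. $\mathcal T$ maps $\mathbb B$ into $\mathbb B$ and is a contraction with modulus $1-(1-\beta)^2\in(0,1)$: $\|\mathcal Tv-\mathcal Tw\|_b\le(1-(1-\beta)^2)\,\|v-w\|_b$ for all $v,w\in\mathbb B$. 2. $J\in\mathbb B$, and $J$ is the unique fixed point of $\mathcal T$ in $\mathbb B$. 3. There is a Markov decision rule $d^*$ with $\mathcal T_{d^*}J(x)=\mathcal TJ(x)$ for all $x\in\mathbb R$. 4. For every Markov decision rule $d^*$ as in 3, the stationary policy $\pi^*=(d^*,d^*,\dots)$ is optimal, that is, $J_{\infty\pi^*}(x)=J_\infty(x)$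 for all $x\in\mathbb R$; and $J_\infty=J$. -/

import Mathlib

open MeasureTheory ProbabilityTheory Filter Topology
open scoped NNReal ENNReal

noncomputable section

namespace Reinsurance

/-! ### Risk measures and premium principles -/

section Functionals

variable {Ω : Type*} [MeasurableSpace Ω]

/-- The random variables in `L^p`. -/
def LpDomain (P : Measure Ω) (p : ℝ≥0∞) : Set (Ω → ℝ) := {X | MemLp X p P}

/-- The nonnegative random variables in `L^p`. -/
def LpNonneg (P : Measure Ω) (p : ℝ≥0∞) : Set (Ω → ℝ) := {X | MemLp X p P ∧ 0 ≤ᵐ[P] X}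

/-! A functional `S → [-∞, ∞]` on a set `S` of random variables is represented by a map
`φ : (Ω → ℝ) → EReal` of which only the values on `S` are constrained. -/

variable (P : Measure Ω) (S : Set (Ω → ℝ)) (φ : (Ω → ℝ) → EReal)

def IsLawInvariant : Prop := ∀ X ∈ S, ∀ Y ∈ S, IdentDistrib X Y P P → φ X = φ Y

def IsMonotone : Prop := ∀ X ∈ S, ∀ Y ∈ S, X ≤ᵐ[P] Y → φ X ≤ φ Y

def IsTranslationInvariant : Prop :=
  ∀ X ∈ S, ∀ m : ℝ, φ (fun ω => X ω + m) = φ X + (m : EReal)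

def IsNormalized : Prop := φ (fun _ => 0) = 0

def IsPositiveHomogeneous : Prop :=
  ∀ X ∈ S, ∀ c : ℝ, 0 ≤ c → φ (fun ω => c * X ω) = (c : EReal) * φ X

def IsSubadditive : Prop := ∀ X ∈ S, ∀ Y ∈ S, φ (fun ω => X ω + Y ω) ≤ φ X + φ Y

/-- Never `-∞`, and smaller than `+∞` in at least one point. -/
def IsProper : Prop := (∀ X ∈ S, φ X ≠ ⊥) ∧ ∃ X ∈ S, φ X < ⊤

/-- Lower semicontinuity along dominated almost surely convergent sequences. -/
def HasFatou : Prop :=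
  ∀ (X : ℕ → Ω → ℝ) (X' Y : Ω → ℝ), (∀ n, X n ∈ S) → X' ∈ S → Y ∈ S →
    (∀ n, ∀ᵐ ω ∂P, |X n ω| ≤ Y ω) →
    (∀ᵐ ω ∂P, Tendsto (fun n => X n ω) atTop (𝓝 (X' ω))) →
    φ X' ≤ liminf (fun n => φ (X n)) atTop

/-- A coherent risk measure: monetary, positive homogeneous and subadditive. -/
structure IsCoherent : Prop where
  monotone : IsMonotone P S φ
  translationInvariant : IsTranslationInvariant S φ
  positiveHomogeneous : IsPositiveHomogeneous S φ
  subadditive : IsSubadditive S φ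

end Functionals

/-! ### Retained loss functions -/

/-- Admissible retained loss functions: `f : ℝ₊ → ℝ₊` with `f t ≤ t` such that both the retained
part `f` and the ceded part `id - f` are increasing. -/
structure RetainedLoss where
  toFun : ℝ≥0 → ℝ≥0
  le_self : ∀ t, toFun t ≤ t
  monotone : Monotone toFun
  monotone_ceded : Monotone fun t : ℝ≥0 => (t : ℝ) - toFun t

namespace RetainedLoss

instance : CoeFun RetainedLoss (fun _ => ℝ≥0 → ℝ≥0) := ⟨toFun⟩

theorem lipschitz (f : RetainedLoss) : LipschitzWith 1 fun t => (f t : ℝ) := by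
  refine LipschitzWith.of_dist_le_mul fun s t => ?_
  rw [NNReal.coe_one, one_mul, NNReal.dist_eq, Real.dist_eq]
  rcases le_total s t with h | h
  · have h1 : (f s : ℝ) ≤ f t := f.monotone h
    have h2 : (s : ℝ) - f s ≤ t - f t := f.monotone_ceded h
    have h3 : (s : ℝ) ≤ t := h
    rw [abs_of_nonpos (by linarith), abs_of_nonpos (by linarith)]
    linarith
  · have h1 : (f t : ℝ) ≤ f s := f.monotone h
    have h2 : (t : ℝ) - f t ≤ s - f s := f.monotone_ceded h
    have h3 : (t : ℝ) ≤ s := h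
    rw [abs_of_nonneg (by linarith), abs_of_nonneg (by linarith)]
    linarith

/-- A retained loss function as an element of `C(ℝ₊, ℝ)`. -/
def toContinuousMap (f : RetainedLoss) : C(ℝ≥0, ℝ) := ⟨fun t => (f t : ℝ), f.lipschitz.continuous⟩

/-- The topology of compact convergence (the compact-open topology of `C(ℝ₊, ℝ)`). -/
instance : TopologicalSpace RetainedLoss :=
  TopologicalSpace.induced toContinuousMap inferInstance

/-- The Borel σ-algebra. -/
instance : MeasurableSpace RetainedLoss := borel RetainedLoss

end RetainedLoss

/-! ### The stationary model -/

/-- The data of the stationary model. The pair `(claim, income)` is the representative `(Y, Z)` of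
the i.i.d. disturbances `(Yₙ, Zₙ)`; `budget` tells whether the budget constraint is imposed. -/
structure Model (Ω : Type*) where
  claim : Ω → ℝ≥0
  income : Ω → ℝ≥0
  risk : (Ω → ℝ) → EReal
  premium : (Ω → ℝ) → EReal
  discount : ℝ
  budget : Prop

namespace Model

variable {Ω : Type*} (M : Model Ω)

/-- The reinsurance premium `π_R(f) = π_R(Y - f(Y))`. -/
def reinsurancePremium (f : RetainedLoss) : EReal :=
  M.premium fun ω => (M.claim ω : ℝ) - f (M.claim ω)

/-- The admissible actions `D(x)`: all retained loss functions in the unconstrained case, those with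
`π_R(f) ≤ x⁺` in the budget-constrained case. -/
def admissible (x : ℝ) : Set RetainedLoss :=
  {f | M.budget → M.reinsurancePremium f ≤ ((max x 0 : ℝ) : EReal)}

/-- The next surplus `x + Z - f(Y) - π_R(f)`. -/
def nextState (x : ℝ) (f : RetainedLoss) (ω : Ω) : ℝ :=
  x + M.income ω - f (M.claim ω) - (M.reinsurancePremium f).toReal

/-- The effective risk `f(Y) + π_R(f) - Z - x + β v(x + Z - f(Y) - π_R(f))` of a period. -/
def effectiveRisk (v : ℝ → ℝ) (x : ℝ) (f : RetainedLoss) (ω : Ω) : ℝ :=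
  f (M.claim ω) + (M.reinsurancePremium f).toReal - M.income ω - x
    + M.discount * v (M.nextState x f ω)

/-- `L v (x, f)`, the risk measure of the effective risk. -/
def costOp (v : ℝ → ℝ) (x : ℝ) (f : RetainedLoss) : EReal := M.risk (M.effectiveRisk v x f)

/-- Markov decision rules: Borel measurable selections of admissible actions. -/
structure MarkovRule where
  toFun : ℝ → RetainedLoss
  measurable : Measurable toFun
  admissible : ∀ x, toFun x ∈ M.admissible x

/-- Markov policies `(d₀, d₁, …)`. -/
def MarkovPolicy : Type := ℕ → M.MarkovRule

variable {M} in
/-- The stationary policy `(d, d, …)`. -/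
def MarkovRule.stationary (d : M.MarkovRule) : M.MarkovPolicy := fun _ => d

/-- The operator `T_d`. -/
def ruleOp (d : M.MarkovRule) (v : ℝ → ℝ) (x : ℝ) : ℝ := (M.costOp v x (d.toFun x)).toReal

/-- The Bellman operator `T`. -/
def bellmanOp (v : ℝ → ℝ) (x : ℝ) : ℝ := (⨅ f ∈ M.admissible x, M.costOp v x f).toReal

/-- The value `J_{Nπ} = T_{d₀} ∘ ⋯ ∘ T_{d_{N-1}} 0` of a Markov policy up to horizon `N`. -/
def policyValue : ℕ → M.MarkovPolicy → ℝ → ℝ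
  | 0, _ => fun _ => 0
  | N + 1, π => M.ruleOp (π 0) (policyValue N fun n => π (n + 1))

/-- `J_N(x) = inf_π J_{Nπ}(x)`. -/
def valueFunction (N : ℕ) (x : ℝ) : ℝ := ⨅ π : M.MarkovPolicy, M.policyValue N π x

/-- `J_{∞π}(x) = lim_N J_{Nπ}(x)`. -/
def policyValueInfinite (π : M.MarkovPolicy) (x : ℝ) : ℝ :=
  limUnder atTop fun N => M.policyValue N π x

/-- `J_∞(x) = inf_π J_{∞π}(x)`. -/
def valueFunctionInfinite (x : ℝ) : ℝ := ⨅ π : M.MarkovPolicy, M.policyValueInfinite π x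

/-- The limit value function `J(x) = lim_N J_N(x)`. -/
def limitValueFunction (x : ℝ) : ℝ := limUnder atTop fun N => M.valueFunction N x

variable [MeasurableSpace Ω] (P : Measure Ω)

/-- `η = ρ(Y) + π_R(Y) + ess sup Z`. -/
def eta : ℝ :=
  (M.risk fun ω => (M.claim ω : ℝ)).toReal + (M.premium fun ω => (M.claim ω : ℝ)).toReal
    + essSup (fun ω => (M.income ω : ℝ)) P

/-- The weight function `b(x) = |x| / (1 - β) + η / (1 - β)²`. -/
def weight (x : ℝ) : ℝ := |x| / (1 - M.discount) + M.eta P / (1 - M.discount) ^ 2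

/-- The space `𝔹` of decreasing lower semicontinuous functions `v` with `|v| ≤ c b` for some
`c ≥ 0`. -/
def valueSpace : Set (ℝ → ℝ) :=
  {v | LowerSemicontinuous v ∧ Antitone v ∧ ∃ c : ℝ, 0 ≤ c ∧ ∀ x, |v x| ≤ c * M.weight P x}

/-- The weighted supremum norm `‖v‖_b = sup_x |v(x)| / b(x)` (with `0 / 0 = 0`). -/
def weightedNorm (v : ℝ → ℝ) : ℝ := ⨆ x, |v x| / M.weight P x

/-- `L v (x, f)` is meaningful: the effective risk lies in `L^p` and its risk is finite. -/
def IsMeaningful (p : ℝ≥0∞) (v : ℝ → ℝ) (x : ℝ) (f : RetainedLoss) : Prop :=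
  M.effectiveRisk v x f ∈ LpDomain P p ∧ M.costOp v x f ≠ ⊥ ∧ M.costOp v x f ≠ ⊤

/-- The standing assumptions on the stationary model. -/
structure IsStationaryModel (p : ℝ≥0∞) : Prop where
  one_le_p : 1 ≤ p
  p_ne_top : p ≠ ⊤
  measurable_claim : Measurable M.claim
  measurable_income : Measurable M.income
  claim_memLp : MemLp (fun ω => (M.claim ω : ℝ)) p P
  income_memLp : MemLp (fun ω => (M.income ω : ℝ)) ⊤ P
  discount_pos : 0 < M.discount
  discount_lt_one : M.discount < 1
  risk_lawInvariant : IsLawInvariant P (LpDomain P p) M.risk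
  risk_proper : IsProper (LpDomain P p) M.risk
  risk_coherent : IsCoherent P (LpDomain P p) M.risk
  risk_fatou : HasFatou P (LpDomain P p) M.risk
  risk_claim_lt_top : M.risk (fun ω => (M.claim ω : ℝ)) < ⊤
  premium_lawInvariant : IsLawInvariant P (LpNonneg P p) M.premium
  premium_monotone : IsMonotone P (LpNonneg P p) M.premium
  premium_normalized : IsNormalized M.premium
  premium_fatou : HasFatou P (LpNonneg P p) M.premium
  premium_claim_lt_top : M.premium (fun ω => (M.claim ω : ℝ)) < ⊤

end Model

end Reinsurance

end

/-!
The value space `𝔹` carries the weight `b(x) = |x| / (1 - β) + η / (1 - β)²`. The effective risk is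
`-s + β v(s)` with the next state `s = x + Z - f(Y) - π_R(f)`, and
`|s| ≤ |x| + Y + π_R(Y) + ess sup Z` almost surely, a bound which is affine in the claim `Y`.
As `ρ(a Y + c) = a ρ(Y) + c` for `a ≥ 0`, coherence makes the risk of every effective risk finite,
and it gives `|L v(x, f) - L w(x, f)| ≤ (1 - (1 - β)²) c b(x)` whenever `|v - w| ≤ c b`
(`abs_costOp_sub_le`). This single estimate yields the contraction property, the convergence of the
values of every policy and the convergence of value iteration. It is used as a pointwise inequality,
so that a zero of the weight (`η = 0`, `x = 0`) matters only in the passage to the weighted norm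
(`abs_le_weightedNorm_mul`).

Two points need more than coherence, and both rest on the Fatou property.

* Minimizing rules. The set of retained loss functions is compact and metrizable, by Arzelà–Ascoli.
  The cost `L v(x, f)` is jointly lower semicontinuous for `v ∈ 𝔹` (`costOp_le_of_tendsto`): the
  premium may drop in the limit, but the effective risk is an antitone lower semicontinuous function
  of the next state, so that its limit is at most the lower limit of the effective risks, and the
  Fatou property applies to the minima with the limit. The partial infimum over the compact space is
  then lower semicontinuous and attained, and the multifunction of minimizers has a measurable
  selection, the lexicographic minimum with respect to a separating sequence of continuous functions
  (`exists_measurable_selection`).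
* Measurability of the values of policies. For Borel measurable `v` and a Markov rule `d`, the map
  `x ↦ L v(x, d(x))` factors through the separable space `L^p` of the law of `(Y, Z)`, on which `ρ` is
  lower semicontinuous (`HasFatou.measurable_param`).

By the existence of minimizing rules, `J_N = T^N 0`; hence `J` is the limit of the value iterates in
the weighted norm, lies in `𝔹` and is the fixed point of `T`. Monotonicity of the cost gives
`J_{Nπ} ≥ T^N 0`, so that `J_{∞π} ≥ J`, with equality for the stationary policy of a minimizing rule.
-/

/-! ### Measurable selection of minimizers -/

namespace Reinsurance

section Selection

variable {X K : Type*} [TopologicalSpace K]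

/-- The minimizers of `u` over the set `s`. -/
def argminOn (u : K → ℝ) (s : Set K) : Set K := {f ∈ s | ∀ g ∈ s, u f ≤ u g}

/-- The minimizers in `A x`, taken successively, of the first `n` functions of the sequence `e`. -/
def lexArgmin (e : ℕ → K → ℝ) (A : X → Set K) : ℕ → X → Set K
  | 0, x => A x
  | n + 1, x => argminOn (e n) (lexArgmin e A n x)

theorem isClosed_argminOn {u : K → ℝ} (hu : Continuous u) {s : Set K} (hs : IsClosed s) :
    IsClosed (argminOn u s) := by
  have : argminOn u s = s ∩ ⋂ g ∈ s, {f | u f ≤ u g} := by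
    ext f
    simp [argminOn]
  rw [this]
  exact hs.inter (isClosed_biInter fun g _ => isClosed_le hu continuous_const)

variable [CompactSpace K]

theorem argminOn_nonempty {u : K → ℝ} (hu : Continuous u) {s : Set K} (hs : IsClosed s)
    (hne : s.Nonempty) : (argminOn u s).Nonempty := by
  obtain ⟨f, hf, hmin⟩ := hs.isCompact.exists_isMinOn hne hu.continuousOn
  exact ⟨f, hf, fun g hg => hmin hg⟩

/-- A closed set meets the minimizers if and only if it meets every nonempty rational sublevel set:
this expresses hitting the minimizers by countably many hitting conditions. -/
theorem argminOn_inter_nonempty_iff {u : K → ℝ} (hu : Continuous u) {s C : Set K}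
    (hs : IsClosed s) (hne : s.Nonempty) (hC : IsClosed C) :
    (argminOn u s ∩ C).Nonempty ↔
      ∀ q : ℚ, (s ∩ {f | u f ≤ q}).Nonempty → (s ∩ (C ∩ {f | u f ≤ q})).Nonempty := by
  constructor
  · rintro ⟨f, ⟨hf, hmin⟩, hfC⟩ q ⟨g, hg, hgq⟩
    exact ⟨f, hf, hfC, (hmin g hg).trans hgq⟩
  · intro h
    have hsC : (s ∩ C).Nonempty := by
      obtain ⟨g, hg⟩ := hne
      obtain ⟨q, hq⟩ := exists_rat_gt (u g)
      obtain ⟨f, hf, hfC, -⟩ := h q ⟨g, hg, hq.le⟩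
      exact ⟨f, hf, hfC⟩
    obtain ⟨f, ⟨hf, hfC⟩, hmin⟩ := argminOn_nonempty hu (hs.inter hC) hsC
    refine ⟨f, ⟨hf, fun g hg => ?_⟩, hfC⟩
    by_contra! hlt
    obtain ⟨q, hq1, hq2⟩ := exists_rat_btwn hlt
    obtain ⟨f', hf', hf'C, hf'q⟩ := h q ⟨g, hg, hq1.le⟩
    exact absurd ((hmin f' ⟨hf', hf'C⟩).trans hf'q) (not_le.2 hq2)

/-- A measurable closed-valued multifunction into a compact space whose points are separated by
countably many continuous functions has a measurable selection. The selection is the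
lexicographic minimum with respect to the separating functions. -/
theorem exists_measurable_selection [MeasurableSpace X] [MeasurableSpace K] [BorelSpace K]
    {A : X → Set K} (hne : ∀ x, (A x).Nonempty) (hcl : ∀ x, IsClosed (A x))
    (hmeas : ∀ C : Set K, IsClosed C → MeasurableSet {x | (A x ∩ C).Nonempty})
    {e : ℕ → K → ℝ} (he : ∀ n, Continuous (e n))
    (hsep : ∀ f g, (∀ n, e n f = e n g) → f = g) :
    ∃ d : X → K, Measurable d ∧ ∀ x, d x ∈ A x := by
  have hcl' : ∀ n x, IsClosed (lexArgmin e A n x) := fun n => by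
    induction n with
    | zero => exact hcl
    | succ n ih => exact fun x => isClosed_argminOn (he n) (ih x)
  have hne' : ∀ n x, (lexArgmin e A n x).Nonempty := fun n => by
    induction n with
    | zero => exact hne
    | succ n ih => exact fun x => argminOn_nonempty (he n) (hcl' n x) (ih x)
  have hmeas' : ∀ n (C : Set K), IsClosed C →
      MeasurableSet {x | (lexArgmin e A n x ∩ C).Nonempty} := fun n => by
    induction n with
    | zero => exact hmeas
    | succ n ih =>
      intro C hC
      have hlevel (q : ℚ) : IsClosed {f | e n f ≤ q} := isClosed_le (he n) continuous_const
      have : {x | (lexArgmin e A (n + 1) x ∩ C).Nonempty} =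
          ⋂ q : ℚ, {x | (lexArgmin e A n x ∩ {f | e n f ≤ q}).Nonempty}ᶜ ∪
            {x | (lexArgmin e A n x ∩ (C ∩ {f | e n f ≤ q})).Nonempty} := by
        ext x
        simp only [lexArgmin, Set.mem_iInter, Set.mem_union, Set.mem_compl_iff, Set.mem_ofPred_eq,
          argminOn_inter_nonempty_iff (he n) (hcl' n x) (hne' n x) hC, imp_iff_not_or]
      rw [this]
      exact MeasurableSet.iInter fun q => (ih _ (hlevel q)).compl.union (ih _ (hC.inter (hlevel q)))
  have hanti : ∀ n x, lexArgmin e A (n + 1) x ⊆ lexArgmin e A n x := fun n x f hf => hf.1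
  have hlim : ∀ x (C : Set K), IsClosed C → (∀ n, (lexArgmin e A n x ∩ C).Nonempty) →
      ∃ f ∈ C, ∀ n, f ∈ lexArgmin e A n x := fun x C hC h => by
    obtain ⟨f, hf⟩ := IsCompact.nonempty_iInter_of_sequence_nonempty_isCompact_isClosed
      (fun n => lexArgmin e A n x ∩ C) (fun n => Set.inter_subset_inter_left C (hanti n x)) h
      ((hcl' 0 x).inter hC).isCompact (fun n => (hcl' n x).inter hC)
    rw [Set.mem_iInter] at hf
    exact ⟨f, (hf 0).2, fun n => (hf n).1⟩
  have huniq : ∀ x f g, (∀ n, f ∈ lexArgmin e A n x) → (∀ n, g ∈ lexArgmin e A n x) → f = g :=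
    fun x f g hf hg => hsep f g fun n =>
      le_antisymm ((hf (n + 1)).2 g (hg n)) ((hg (n + 1)).2 f (hf n))
  choose d _ hd using fun x => hlim x Set.univ isClosed_univ fun n => by simpa using hne' n x
  refine ⟨d, measurable_of_isClosed fun C hC => ?_, fun x => hd x 0⟩
  have : d ⁻¹' C = ⋂ n, {x | (lexArgmin e A n x ∩ C).Nonempty} := by
    ext x
    simp only [Set.mem_preimage, Set.mem_iInter, Set.mem_ofPred_eq]
    refine ⟨fun h n => ⟨d x, hd x n, h⟩, fun h => ?_⟩
    obtain ⟨f, hfC, hf⟩ := hlim x C hC h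
    rwa [huniq x (d x) f (hd x) hf]
  rw [this]
  exact MeasurableSet.iInter fun n => hmeas' n C hC

variable [TopologicalSpace X]

/-- The partial infimum of a lower semicontinuous function over a closed subset of a compact space
is lower semicontinuous. -/
theorem lowerSemicontinuous_biInf {Φ : X × K → EReal} (hΦ : LowerSemicontinuous Φ) {C : Set K}
    (hC : IsClosed C) : LowerSemicontinuous fun x => ⨅ f ∈ C, Φ (x, f) := by
  rcases C.eq_empty_or_nonempty with rfl | hne
  · simpa using lowerSemicontinuous_const
  rw [lowerSemicontinuous_iff_isClosed_preimage]
  intro c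
  have : (fun x => ⨅ f ∈ C, Φ (x, f)) ⁻¹' Set.Iic c =
      Prod.fst '' (Φ ⁻¹' Set.Iic c ∩ Set.univ ×ˢ C) := by
    ext x
    simp only [Set.mem_preimage, Set.mem_Iic, Set.mem_image, Set.mem_inter_iff, Set.mem_prod,
      Set.mem_univ, true_and, Prod.exists, exists_and_right, exists_eq_right]
    constructor
    · intro h
      obtain ⟨f, hf, hmin⟩ := LowerSemicontinuousOn.exists_isMinOn hne hC.isCompact
        ((hΦ.comp (Continuous.prodMk_right x)).lowerSemicontinuousOn C)
      exact ⟨f, (le_iInf₂ fun g hg => hmin hg).trans h, hf⟩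
    · rintro ⟨f, hf, hfC⟩
      exact (iInf₂_le f hfC).trans hf
  rw [this]
  exact isClosedMap_fst_of_compactSpace _
    ((hΦ.isClosed_preimage c).inter (isClosed_univ.prod hC))

/-- A jointly lower semicontinuous function on a product with a compact space, whose points are
separated by countably many continuous functions, has a measurable minimizer. -/
theorem exists_measurable_minimizer [MeasurableSpace X] [BorelSpace X] [MeasurableSpace K]
    [BorelSpace K] [Nonempty K] {Φ : X × K → EReal} (hΦ : LowerSemicontinuous Φ)
    {e : ℕ → K → ℝ} (he : ∀ n, Continuous (e n))
    (hsep : ∀ f g, (∀ n, e n f = e n g) → f = g) :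
    ∃ d : X → K, Measurable d ∧ ∀ x, Φ (x, d x) = ⨅ f, Φ (x, f) := by
  have hΦx (x : X) : LowerSemicontinuous fun f => Φ (x, f) := hΦ.comp (Continuous.prodMk_right x)
  have hmin (x : X) {C : Set K} (hC : IsClosed C) (hne : C.Nonempty) :
      ∃ f ∈ C, Φ (x, f) = ⨅ g ∈ C, Φ (x, g) := by
    obtain ⟨f, hf, hmin⟩ := LowerSemicontinuousOn.exists_isMinOn hne hC.isCompact
      ((hΦx x).lowerSemicontinuousOn C)
    exact ⟨f, hf, le_antisymm (le_iInf₂ fun g hg => hmin hg) (iInf₂_le f hf)⟩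
  have hne (x : X) : {f | Φ (x, f) ≤ ⨅ g, Φ (x, g)}.Nonempty := by
    obtain ⟨f, -, hf⟩ := hmin x isClosed_univ Set.univ_nonempty
    exact ⟨f, by simpa using hf.le⟩
  have hhit (C : Set K) (hC : IsClosed C) :
      MeasurableSet {x | ({f | Φ (x, f) ≤ ⨅ g, Φ (x, g)} ∩ C).Nonempty} := by
    rcases C.eq_empty_or_nonempty with rfl | hne
    · simp
    have : {x | ({f | Φ (x, f) ≤ ⨅ g, Φ (x, g)} ∩ C).Nonempty} =
        {x | ⨅ f ∈ C, Φ (x, f) ≤ ⨅ f ∈ Set.univ, Φ (x, f)} := by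
      ext x
      simp only [Set.mem_ofPred_eq, Set.mem_univ, iInf_pos]
      constructor
      · rintro ⟨f, hf, hfC⟩
        exact (iInf₂_le f hfC).trans hf
      · intro h
        obtain ⟨f, hfC, hf⟩ := hmin x hC hne
        exact ⟨f, hf.le.trans h, hfC⟩
    rw [this]
    exact measurableSet_le (lowerSemicontinuous_biInf hΦ hC).measurable
      (lowerSemicontinuous_biInf hΦ isClosed_univ).measurable
  obtain ⟨d, hd, hdA⟩ := exists_measurable_selection hne
    (fun x => (hΦx x).isClosed_preimage _) hhit he hsep
  exact ⟨d, hd, fun x => le_antisymm (hdA x) (iInf_le _ _)⟩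

end Selection

end Reinsurance

/-! ### The space of retained loss functions -/

namespace Reinsurance.RetainedLoss

instance : BorelSpace RetainedLoss := ⟨rfl⟩

theorem toContinuousMap_injective : Function.Injective toContinuousMap := by
  rintro ⟨f, _, _, _⟩ ⟨g, _, _, _⟩ h
  congr 1
  funext t
  exact NNReal.coe_injective (DFunLike.congr_fun h t)

theorem isEmbedding_toContinuousMap : IsEmbedding toContinuousMap :=
  ⟨⟨rfl⟩, toContinuousMap_injective⟩

instance : TopologicalSpace.MetrizableSpace RetainedLoss :=
  isEmbedding_toContinuousMap.metrizableSpace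

theorem continuous_eval : Continuous fun q : RetainedLoss × ℝ≥0 => (q.1 q.2 : ℝ) := by
  have h : Continuous fun q : RetainedLoss × ℝ≥0 => toContinuousMap q.1 q.2 :=
    (isEmbedding_toContinuousMap.continuous.comp continuous_fst).eval continuous_snd
  exact h

theorem continuous_apply (t : ℝ≥0) : Continuous fun f : RetainedLoss => (f t : ℝ) :=
  continuous_eval.comp (Continuous.prodMk_left t)

theorem measurable_coe (f : RetainedLoss) : Measurable fun t => (f t : ℝ) :=
  f.lipschitz.continuous.measurable

/-- Retained loss functions are equicontinuous, so that compact convergence is pointwise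
convergence. -/
theorem isInducing_coe : IsInducing fun (f : RetainedLoss) (t : ℝ≥0) => (f t : ℝ) := by
  have h1 : IsInducing (UniformOnFun.ofFun {K : Set ℝ≥0 | IsCompact K} ∘
      fun (f : RetainedLoss) (t : ℝ≥0) => (f t : ℝ)) :=
    (ContinuousMap.isUniformEmbedding_toUniformOnFunIsCompact (α := ℝ≥0)
      (β := ℝ)).isEmbedding.isInducing.comp isEmbedding_toContinuousMap.isInducing
  refine (EquicontinuousOn.isInducing_uniformOnFun_iff_pi
    (Set.eq_univ_of_forall fun t => ⟨{t}, isCompact_singleton, rfl⟩) (fun K hK => hK)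
    fun K _ => ?_).1 h1
  exact (LipschitzWith.uniformEquicontinuous _ 1 fun f => f.lipschitz).equicontinuous
    |>.equicontinuousOn K

/-- Compactness by the theorems of Arzelà–Ascoli and Tychonoff. -/
instance : CompactSpace RetainedLoss := by
  rw [← isCompact_univ_iff, isInducing_coe.isCompact_iff, Set.image_univ]
  refine IsCompact.of_isClosed_subset
    (isCompact_univ_pi fun t : ℝ≥0 => isCompact_Icc (a := (0 : ℝ)) (b := t)) ?_
    (Set.range_subset_iff.2 fun f t _ => ⟨(f t).2, f.le_self t⟩)
  have : Set.range (fun (f : RetainedLoss) (t : ℝ≥0) => (f t : ℝ)) =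
      {g : ℝ≥0 → ℝ | (∀ t, 0 ≤ g t) ∧ (∀ t : ℝ≥0, g t ≤ t) ∧ (∀ s t, s ≤ t → g s ≤ g t) ∧
        ∀ s t : ℝ≥0, s ≤ t → (s : ℝ) - g s ≤ t - g t} := by
    ext g
    constructor
    · rintro ⟨f, rfl⟩
      exact ⟨fun t => (f t).2, fun t => f.le_self t, fun s t h => f.monotone h,
        fun s t h => f.monotone_ceded h⟩
    · rintro ⟨h0, h1, h2, h3⟩
      exact ⟨⟨fun t => ⟨g t, h0 t⟩, h1, fun s t h => h2 s t h, fun s t h => h3 s t h⟩, rfl⟩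
  rw [this]
  simp only [Set.ofPred_and, Set.ofPred_forall]
  refine (isClosed_iInter fun t => ?_).inter <| (isClosed_iInter fun t => ?_).inter <|
    (isClosed_iInter fun s => isClosed_iInter fun t => isClosed_iInter fun _ => ?_).inter
    (isClosed_iInter fun s => isClosed_iInter fun t => isClosed_iInter fun _ => ?_)
  all_goals exact isClosed_le (by fun_prop) (by fun_prop)

/-- Full retention: no risk is ceded. -/
def full : RetainedLoss := ⟨fun t => t, fun _ => le_rfl, monotone_id, fun _ _ _ => by simp⟩

instance : Nonempty RetainedLoss := ⟨full⟩

theorem eq_of_eq_on_denseSeq (f g : RetainedLoss)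
    (h : ∀ n, (f (TopologicalSpace.denseSeq ℝ≥0 n) : ℝ) = g (TopologicalSpace.denseSeq ℝ≥0 n)) :
    f = g := by
  refine toContinuousMap_injective (DFunLike.ext' ?_)
  refine Continuous.ext_on (TopologicalSpace.denseRange_denseSeq ℝ≥0)
    (toContinuousMap f).continuous (toContinuousMap g).continuous ?_
  rintro _ ⟨n, rfl⟩
  exact h n

end Reinsurance.RetainedLoss

/-! ### Measurability of functionals with the Fatou property -/

namespace Reinsurance

theorem measurable_of_measurable_edist {X E : Type*} [MeasurableSpace X] [PseudoEMetricSpace E]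
    [SecondCountableTopology E] [MeasurableSpace E] [BorelSpace E] {F : X → E}
    (hF : ∀ y, Measurable fun x => edist (F x) y) : Measurable F := by
  refine measurable_of_isOpen fun U hU => ?_
  have hball (q : E × ℝ≥0∞) : IsOpen (Metric.eball q.1 q.2) := Metric.isOpen_eball
  have hUeq : U = ⋃ q ∈ {q : E × ℝ≥0∞ | Metric.eball q.1 q.2 ⊆ U}, Metric.eball q.1 q.2 := by
    refine Set.Subset.antisymm (fun y hy => ?_) (Set.iUnion₂_subset fun q hq => hq)
    obtain ⟨ε, hε, hsub⟩ := EMetric.isOpen_iff.1 hU y hy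
    exact Set.mem_biUnion (x := (y, ε)) hsub (Metric.mem_eball_self hε)
  obtain ⟨T, -, hT, hTU⟩ := TopologicalSpace.isOpen_biUnion_countable
    {q : E × ℝ≥0∞ | Metric.eball q.1 q.2 ⊆ U} (fun q => Metric.eball q.1 q.2) fun q _ => hball q
  rw [hUeq, ← hTU, Set.preimage_iUnion₂]
  exact MeasurableSet.biUnion hT fun q _ => measurableSet_lt (hF q.1) measurable_const

/-- A convergent sequence in `L^p` has a subsequence which converges almost everywhere and is
dominated by an element of `L^p`. -/
theorem exists_subseq_ae_tendsto_dominated {E : Type*} [MeasurableSpace E] {ν : Measure E}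
    {p : ℝ≥0∞} [Fact (1 ≤ p)] {g : ℕ → Lp ℝ p ν} {g' : Lp ℝ p ν}
    (hg : Tendsto g atTop (𝓝 g')) :
    ∃ (φ : ℕ → ℕ) (W : Lp ℝ p ν), (∀ n, ∀ᵐ y ∂ν, |g (φ n) y| ≤ W y) ∧
      ∀ᵐ y ∂ν, Tendsto (fun n => g (φ n) y) atTop (𝓝 (g' y)) := by
  -- Along a fast subsequence the distances to the limit have a sum, which yields the dominant.
  have hfast (n : ℕ) : ∃ m, n ≤ m ∧ ‖g m - g'‖ ≤ (1 / 2 : ℝ) ^ n := by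
    have hev := (tendsto_iff_norm_sub_tendsto_zero.1 hg).eventually_lt_const
      (show (0 : ℝ) < (1 / 2) ^ n by positivity)
    obtain ⟨m, hm1, hm2⟩ := (hev.and (eventually_ge_atTop n)).exists
    exact ⟨m, hm2, hm1.le⟩
  choose ψ hψn hψ using hfast
  have hψlim : Tendsto (fun n => g (ψ n)) atTop (𝓝 g') :=
    hg.comp (tendsto_atTop_mono hψn tendsto_id)
  obtain ⟨ns, -, hae⟩ := (tendstoInMeasure_of_tendsto_Lp hψlim).exists_seq_tendsto_ae
  have hsum : Summable fun n => |g (ψ n) - g'| :=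
    Summable.of_norm_bounded summable_geometric_two fun n => by
      rw [norm_abs_eq_norm]
      exact hψ n
  refine ⟨fun n => ψ (ns n), (∑' n, |g (ψ n) - g'|) + |g'|, fun n => ?_, hae⟩
  have hle : |g (ψ (ns n))| ≤ (∑' n, |g (ψ n) - g'|) + |g'| := by
    calc |g (ψ (ns n))| = |(g (ψ (ns n)) - g') + g'| := by rw [sub_add_cancel]
      _ ≤ |g (ψ (ns n)) - g'| + |g'| := abs_add_le _ _
      _ ≤ _ := by
        gcongr
        exact hsum.le_tsum (ns n) fun _ _ => abs_nonneg _
  filter_upwards [Lp.coeFn_abs (g (ψ (ns n))), (Lp.coeFn_le _ _).2 hle] with y h1 h2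
  rw [← h1]
  exact h2

section Fatou

variable {Ω : Type*} [MeasurableSpace Ω] {P : Measure Ω} {p : ℝ≥0∞} {φ : (Ω → ℝ) → EReal}
  {E : Type*} [MeasurableSpace E] {V : Ω → E}

theorem HasFatou.le_of_tendsto {S : Set (Ω → ℝ)} (hφ : HasFatou P S φ) {X : ℕ → Ω → ℝ}
    {X' W : Ω → ℝ} {c : EReal} (hX : ∀ n, X n ∈ S) (hX' : X' ∈ S) (hW : W ∈ S)
    (hdom : ∀ n, ∀ᵐ ω ∂P, |X n ω| ≤ W ω)
    (hlim : ∀ᵐ ω ∂P, Tendsto (fun n => X n ω) atTop (𝓝 (X' ω))) (hc : ∀ n, φ (X n) ≤ c) :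
    φ X' ≤ c :=
  (hφ X X' W hX hX' hW hdom hlim).trans <|
    (liminf_le_liminf (Eventually.of_forall hc)).trans (liminf_const _).le

theorem HasFatou.congr_ae (hφ : HasFatou P (LpDomain P p) φ) {X X' : Ω → ℝ}
    (hX : MemLp X p P) (h : X =ᵐ[P] X') : φ X = φ X' := by
  have key {X X' : Ω → ℝ} (hX : MemLp X p P) (h : X =ᵐ[P] X') : φ X' ≤ φ X :=
    hφ.le_of_tendsto (X := fun _ => X) (W := fun ω => |X ω|) (fun _ => hX)
      ((memLp_congr_ae h).1 hX) hX.abs (fun _ => Eventually.of_forall fun _ => le_rfl)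
      (h.mono fun ω hω => hω ▸ tendsto_const_nhds) fun _ => le_rfl
  exact le_antisymm (key ((memLp_congr_ae h).1 hX) h.symm) (key hX h)

/-- A functional with the Fatou property, restricted to the functions of a random element `V`, is
lower semicontinuous on `L^p` of the law of `V`. -/
theorem HasFatou.isClosed_sublevel [Fact (1 ≤ p)] (hφ : HasFatou P (LpDomain P p) φ)
    (hV : Measurable V) (c : EReal) :
    IsClosed {g : Lp ℝ p (P.map V) | φ (fun ω => g (V ω)) ≤ c} := by
  refine IsSeqClosed.isClosed fun g g' hg hlim => ?_
  obtain ⟨ψ, W, hdom, hae⟩ := exists_subseq_ae_tendsto_dominated hlim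
  have hmem (h : Lp ℝ p (P.map V)) : MemLp (fun ω => h (V ω)) p P :=
    (Lp.memLp h).comp_of_map hV.aemeasurable
  exact hφ.le_of_tendsto (fun n => hmem (g (ψ n))) (hmem g') (hmem W)
    (fun n => ae_of_ae_map hV.aemeasurable (hdom n)) (ae_of_ae_map hV.aemeasurable hae)
    fun n => hg (ψ n)

/-- A functional with the Fatou property depends measurably on a parameter of a jointly measurable
integrand: the parametrized integrand is a measurable map into the separable space `L^p` of the law
of `V`, on which the functional is lower semicontinuous. -/
theorem HasFatou.measurable_param [MeasurableSpace.CountablyGenerated E] [IsFiniteMeasure P]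
    [Fact (1 ≤ p)] (hp : p ≠ ⊤) (hφ : HasFatou P (LpDomain P p) φ) (hV : Measurable V)
    {X : Type*} [MeasurableSpace X] {G : X × E → ℝ} (hG : Measurable G)
    (hmem : ∀ x, MemLp (fun ω => G (x, V ω)) p P) :
    Measurable fun x => φ fun ω => G (x, V ω) := by
  have hGx (x : X) : Measurable fun y => G (x, y) := hG.comp measurable_prodMk_left
  have hmem' (x : X) : MemLp (fun y => G (x, y)) p (P.map V) :=
    (memLp_map_measure_iff (hGx x).aestronglyMeasurable hV.aemeasurable).2 (hmem x)
  have : Fact (p ≠ ⊤) := ⟨hp⟩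
  let _ : MeasurableSpace (Lp ℝ p (P.map V)) := borel _
  have : BorelSpace (Lp ℝ p (P.map V)) := ⟨rfl⟩
  have hp0 : p ≠ 0 := (zero_lt_one.trans_le Fact.out).ne'
  have hmeas : Measurable fun x => (hmem' x).toLp := by
    refine measurable_of_measurable_edist fun s => ?_
    have hs : Measurable (s : E → ℝ) := (Lp.stronglyMeasurable s).measurable
    have : (fun x => edist (hmem' x).toLp s) =
        fun x => (∫⁻ y, ‖G (x, y) - s y‖ₑ ^ p.toReal ∂(P.map V)) ^ (1 / p.toReal) := by
      ext x
      conv_lhs => rw [← Lp.toLp_coeFn s (Lp.memLp s)]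
      rw [Lp.edist_toLp_toLp, eLpNorm_eq_lintegral_rpow_enorm_toReal hp0 hp]
      rfl
    rw [this]
    refine Measurable.pow_const ?_ _
    exact Measurable.lintegral_prod_right'
      (f := fun q : X × E => ‖G q - s q.2‖ₑ ^ p.toReal) (by fun_prop)
  refine measurable_of_Iic fun c => ?_
  have : (fun x => φ fun ω => G (x, V ω)) ⁻¹' Set.Iic c =
      (fun x => (hmem' x).toLp) ⁻¹' {g | φ (fun ω => g (V ω)) ≤ c} := by
    ext x
    have hae : (fun ω => G (x, V ω)) =ᵐ[P] fun ω => (hmem' x).toLp _ (V ω) :=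
      (ae_of_ae_map hV.aemeasurable (hmem' x).coeFn_toLp).mono fun ω hω => hω.symm
    simp only [Set.mem_preimage, Set.mem_Iic, Set.mem_ofPred_eq, hφ.congr_ae (hmem x) hae]
  rw [this]
  exact hmeas (hφ.isClosed_sublevel hV c).measurableSet

end Fatou

end Reinsurance

/-! ### Bounds for the premium, the risk and the income -/

namespace Reinsurance.Model

theorem effectiveRisk_eq {Ω : Type*} (M : Model Ω) (v : ℝ → ℝ) (x : ℝ) (f : RetainedLoss) (ω : Ω) :
    M.effectiveRisk v x f ω = -M.nextState x f ω + M.discount * v (M.nextState x f ω) := by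
  simp only [effectiveRisk, nextState]
  ring

variable {Ω : Type*} [MeasurableSpace Ω] {P : Measure Ω} {p : ℝ≥0∞} {M : Model Ω}

namespace IsStationaryModel

theorem measurable_retained (hM : M.IsStationaryModel P p) (f : RetainedLoss) :
    Measurable fun ω => (f (M.claim ω) : ℝ) :=
  f.measurable_coe.comp hM.measurable_claim

theorem ceded_mem (hM : M.IsStationaryModel P p) (f : RetainedLoss) :
    (fun ω => (M.claim ω : ℝ) - f (M.claim ω)) ∈ LpNonneg P p := by
  have hle (ω : Ω) : (f (M.claim ω) : ℝ) ≤ M.claim ω := f.le_self _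
  refine ⟨hM.claim_memLp.mono
    (hM.claim_memLp.aestronglyMeasurable.sub (hM.measurable_retained f).aestronglyMeasurable)
    (Eventually.of_forall fun ω => ?_), Eventually.of_forall fun ω => sub_nonneg.2 (hle ω)⟩
  rw [Real.norm_of_nonneg (sub_nonneg.2 (hle ω)), Real.norm_of_nonneg (NNReal.coe_nonneg _)]
  exact sub_le_self _ (f _).2

theorem claim_mem (hM : M.IsStationaryModel P p) :
    (fun ω => (M.claim ω : ℝ)) ∈ LpNonneg P p :=
  ⟨hM.claim_memLp, Eventually.of_forall fun ω => (M.claim ω).2⟩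

theorem reinsurancePremium_nonneg (hM : M.IsStationaryModel P p) (f : RetainedLoss) :
    0 ≤ M.reinsurancePremium f := by
  rw [← hM.premium_normalized]
  exact hM.premium_monotone _ ⟨MemLp.zero, Eventually.of_forall fun _ => le_rfl⟩ _ (hM.ceded_mem f)
    (hM.ceded_mem f).2

theorem reinsurancePremium_le (hM : M.IsStationaryModel P p) (f : RetainedLoss) :
    M.reinsurancePremium f ≤ M.premium fun ω => (M.claim ω : ℝ) :=
  hM.premium_monotone _ (hM.ceded_mem f) _ hM.claim_mem
    (Eventually.of_forall fun _ => sub_le_self _ (f _).2)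

theorem coe_reinsurancePremium (hM : M.IsStationaryModel P p) (f : RetainedLoss) :
    ((M.reinsurancePremium f).toReal : EReal) = M.reinsurancePremium f :=
  EReal.coe_toReal ((hM.reinsurancePremium_le f).trans_lt hM.premium_claim_lt_top).ne
    (EReal.bot_lt_zero.trans_le (hM.reinsurancePremium_nonneg f)).ne'

theorem toReal_reinsurancePremium_nonneg (hM : M.IsStationaryModel P p) (f : RetainedLoss) :
    0 ≤ (M.reinsurancePremium f).toReal :=
  EReal.toReal_nonneg (hM.reinsurancePremium_nonneg f)

theorem toReal_reinsurancePremium_le (hM : M.IsStationaryModel P p) (f : RetainedLoss) :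
    (M.reinsurancePremium f).toReal ≤ (M.premium fun ω => (M.claim ω : ℝ)).toReal :=
  EReal.toReal_le_toReal (hM.reinsurancePremium_le f)
    (EReal.bot_lt_zero.trans_le (hM.reinsurancePremium_nonneg f)).ne' hM.premium_claim_lt_top.ne

theorem full_mem_admissible (hM : M.IsStationaryModel P p) (x : ℝ) :
    RetainedLoss.full ∈ M.admissible x := fun _ => by
  have : M.reinsurancePremium RetainedLoss.full = 0 := by
    simpa [reinsurancePremium, RetainedLoss.full] using show M.premium (fun _ => 0) = 0 from
      hM.premium_normalized
  rw [this]
  exact_mod_cast le_max_right x 0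

theorem lowerSemicontinuous_reinsurancePremium (hM : M.IsStationaryModel P p) :
    LowerSemicontinuous M.reinsurancePremium := by
  refine lowerSemicontinuous_iff_isClosed_preimage.2 fun c =>
    IsSeqClosed.isClosed fun f f' hf hlim => ?_
  refine hM.premium_fatou.le_of_tendsto (fun n => hM.ceded_mem (f n)) (hM.ceded_mem f')
    hM.claim_mem (fun n => Eventually.of_forall fun ω => ?_)
    (Eventually.of_forall fun ω => ?_) hf
  · have hle : ((f n) (M.claim ω) : ℝ) ≤ M.claim ω := (f n).le_self _
    rw [abs_of_nonneg (sub_nonneg.2 hle)]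
    exact sub_le_self _ ((f n) _).2
  · exact tendsto_const_nhds.sub (((RetainedLoss.continuous_apply _).tendsto f').comp hlim)

theorem risk_zero (hM : M.IsStationaryModel P p) : M.risk (fun _ => 0) = 0 := by
  simpa using hM.risk_coherent.positiveHomogeneous _ hM.claim_memLp 0 le_rfl

theorem coe_risk_claim (hM : M.IsStationaryModel P p) :
    ((M.risk fun ω => (M.claim ω : ℝ)).toReal : EReal) = M.risk fun ω => (M.claim ω : ℝ) :=
  EReal.coe_toReal hM.risk_claim_lt_top.ne (hM.risk_proper.1 _ hM.claim_memLp)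

theorem risk_claim_nonneg (hM : M.IsStationaryModel P p) :
    0 ≤ (M.risk fun ω => (M.claim ω : ℝ)).toReal := by
  refine EReal.toReal_nonneg ?_
  rw [← hM.risk_zero]
  exact hM.risk_coherent.monotone _ MemLp.zero _ hM.claim_memLp hM.claim_mem.2

theorem income_le_essSup (hM : M.IsStationaryModel P p) :
    ∀ᵐ ω ∂P, (M.income ω : ℝ) ≤ essSup (fun ω => (M.income ω : ℝ)) P := by
  refine ae_le_essSup ⟨(eLpNormEssSup (fun ω => (M.income ω : ℝ)) P).toReal, ?_⟩
  have hfin : eLpNormEssSup (fun ω => (M.income ω : ℝ)) P ≠ ⊤ := by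
    simpa using hM.income_memLp.2.ne
  rw [eventually_map]
  filter_upwards [ae_le_eLpNormEssSup (f := fun ω => (M.income ω : ℝ)) (μ := P)] with ω hω
  have := ENNReal.toReal_mono hfin hω
  simpa using this

theorem measurable_nextState (hM : M.IsStationaryModel P p) (x : ℝ) (f : RetainedLoss) :
    Measurable (M.nextState x f) :=
  ((measurable_const.add hM.measurable_income.coe_nnreal_real).sub
    (hM.measurable_retained f)).sub measurable_const

theorem measurable_effectiveRisk (hM : M.IsStationaryModel P p) {v : ℝ → ℝ} (hv : Measurable v)
    (x : ℝ) (f : RetainedLoss) : Measurable (M.effectiveRisk v x f) := by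
  rw [funext (M.effectiveRisk_eq v x f)]
  have := hM.measurable_nextState x f
  fun_prop

theorem abs_nextState_le (hM : M.IsStationaryModel P p) :
    ∀ᵐ ω ∂P, ∀ x f, |M.nextState x f ω| ≤
      M.claim ω + (|x| + (M.premium fun ω => (M.claim ω : ℝ)).toReal
        + essSup (fun ω => (M.income ω : ℝ)) P) := by
  filter_upwards [hM.income_le_essSup] with ω hω x f
  have h1 : (f (M.claim ω) : ℝ) ≤ M.claim ω := f.le_self _
  have h2 : (0 : ℝ) ≤ f (M.claim ω) := (f _).2
  have h3 := hM.toReal_reinsurancePremium_nonneg f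
  have h4 := hM.toReal_reinsurancePremium_le f
  have h5 : (0 : ℝ) ≤ M.income ω := (M.income ω).2
  unfold nextState
  rw [abs_le]
  constructor <;> linarith [neg_abs_le x, le_abs_self x]

theorem abs_effectiveRisk_le (hM : M.IsStationaryModel P p) {v : ℝ → ℝ} {c : ℝ} (hc : 0 ≤ c)
    (hv : ∀ x, |v x| ≤ c * M.weight P x) :
    ∀ᵐ ω ∂P, ∀ x f, |M.effectiveRisk v x f ω| ≤
      (1 + M.discount * c / (1 - M.discount)) * M.claim ω +
        ((1 + M.discount * c / (1 - M.discount)) *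
          (|x| + (M.premium fun ω => (M.claim ω : ℝ)).toReal
            + essSup (fun ω => (M.income ω : ℝ)) P)
          + M.discount * c * (M.eta P / (1 - M.discount) ^ 2)) := by
  filter_upwards [hM.abs_nextState_le] with ω hω x f
  have hβ := hM.discount_pos
  have hβ1 := sub_pos.2 hM.discount_lt_one
  set s := M.nextState x f ω with hs
  rw [effectiveRisk_eq, ← hs]
  calc |-s + M.discount * v s| ≤ |-s| + |M.discount * v s| := abs_add_le _ _
    _ = |s| + M.discount * |v s| := by rw [abs_neg, abs_mul, abs_of_pos hβ]
    _ ≤ |s| + M.discount * (c * M.weight P s) := by gcongr; exact hv s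
    _ = (1 + M.discount * c / (1 - M.discount)) * |s|
        + M.discount * c * (M.eta P / (1 - M.discount) ^ 2) := by
      unfold weight
      ring
    _ ≤ (1 + M.discount * c / (1 - M.discount)) * (M.claim ω +
          (|x| + (M.premium fun ω => (M.claim ω : ℝ)).toReal
            + essSup (fun ω => (M.income ω : ℝ)) P))
        + M.discount * c * (M.eta P / (1 - M.discount) ^ 2) := by
      gcongr
      exact hω x f
    _ = _ := by ring

variable [IsProbabilityMeasure P]

theorem memLp_affine_claim (hM : M.IsStationaryModel P p) (a c : ℝ) :
    MemLp (fun ω => a * (M.claim ω : ℝ) + c) p P :=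
  (hM.claim_memLp.const_mul a).add (memLp_const c)

theorem memLp_of_abs_le (hM : M.IsStationaryModel P p) {X : Ω → ℝ} (hX : Measurable X) {a c : ℝ}
    (h : ∀ᵐ ω ∂P, |X ω| ≤ a * M.claim ω + c) : MemLp X p P :=
  (hM.memLp_affine_claim a c).mono hX.aestronglyMeasurable
    (h.mono fun _ hω => hω.trans (le_abs_self _))

theorem risk_le_of_le (hM : M.IsStationaryModel P p) {X : Ω → ℝ} (hX : MemLp X p P) {a c : ℝ}
    (ha : 0 ≤ a) (h : ∀ᵐ ω ∂P, X ω ≤ a * M.claim ω + c) :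
    M.risk X ≤ ((a * (M.risk fun ω => (M.claim ω : ℝ)).toReal + c : ℝ) : EReal) := by
  refine (hM.risk_coherent.monotone _ hX _ (hM.memLp_affine_claim a c) h).trans_eq ?_
  rw [hM.risk_coherent.translationInvariant _ (hM.claim_memLp.const_mul a) c,
    hM.risk_coherent.positiveHomogeneous _ hM.claim_memLp a ha, ← hM.coe_risk_claim]
  norm_cast

theorem coe_risk (hM : M.IsStationaryModel P p) {X : Ω → ℝ} (hX : MemLp X p P) {a c : ℝ}
    (ha : 0 ≤ a) (h : ∀ᵐ ω ∂P, |X ω| ≤ a * M.claim ω + c) :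
    ((M.risk X).toReal : EReal) = M.risk X :=
  EReal.coe_toReal ((hM.risk_le_of_le hX ha
    (h.mono fun _ hω => (le_abs_self _).trans hω)).trans_lt (EReal.coe_lt_top _)).ne
    (hM.risk_proper.1 _ hX)

/-- The risk is Lipschitz with respect to bounds which are affine in the claim. -/
theorem toReal_risk_le_add (hM : M.IsStationaryModel P p) {X X' : Ω → ℝ} (hX : MemLp X p P)
    (hX' : MemLp X' p P) (hfin : ((M.risk X).toReal : EReal) = M.risk X)
    (hfin' : ((M.risk X').toReal : EReal) = M.risk X') {a c : ℝ} (ha : 0 ≤ a)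
    (h : ∀ᵐ ω ∂P, X ω - X' ω ≤ a * M.claim ω + c) :
    (M.risk X).toReal ≤
      (M.risk X').toReal + (a * (M.risk fun ω => (M.claim ω : ℝ)).toReal + c) := by
  rw [← EReal.coe_le_coe_iff, EReal.coe_add, hfin, hfin']
  calc M.risk X = M.risk fun ω => X' ω + (X ω - X' ω) := by simp
    _ ≤ M.risk X' + M.risk fun ω => X ω - X' ω :=
        hM.risk_coherent.subadditive _ hX' _ (hX.sub hX')
    _ ≤ _ := by
        gcongr
        exact hM.risk_le_of_le (hX.sub hX') ha h

theorem abs_toReal_risk_sub_le (hM : M.IsStationaryModel P p) {X X' : Ω → ℝ} (hX : MemLp X p P)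
    (hX' : MemLp X' p P) (hfin : ((M.risk X).toReal : EReal) = M.risk X)
    (hfin' : ((M.risk X').toReal : EReal) = M.risk X') {a c : ℝ} (ha : 0 ≤ a)
    (h : ∀ᵐ ω ∂P, |X ω - X' ω| ≤ a * M.claim ω + c) :
    |(M.risk X).toReal - (M.risk X').toReal| ≤
      a * (M.risk fun ω => (M.claim ω : ℝ)).toReal + c := by
  rw [abs_sub_le_iff]
  constructor
  · linarith [hM.toReal_risk_le_add hX hX' hfin hfin' ha
      (h.mono fun ω hω => (le_abs_self _).trans hω)]
  · linarith [hM.toReal_risk_le_add hX' hX hfin' hfin ha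
      (h.mono fun ω hω => (le_abs_self _).trans ((abs_sub_comm _ _).trans_le hω))]

theorem essSup_income_nonneg (hM : M.IsStationaryModel P p) :
    0 ≤ essSup (fun ω => (M.income ω : ℝ)) P := by
  obtain ⟨ω, hω⟩ := hM.income_le_essSup.exists
  exact (M.income ω).2.trans hω

theorem eta_nonneg (hM : M.IsStationaryModel P p) : 0 ≤ M.eta P := by
  have h1 := hM.risk_claim_nonneg
  have h2 := (hM.toReal_reinsurancePremium_nonneg RetainedLoss.full).trans
    (hM.toReal_reinsurancePremium_le RetainedLoss.full)
  have h3 := hM.essSup_income_nonneg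
  unfold eta
  positivity

theorem weight_nonneg (hM : M.IsStationaryModel P p) (x : ℝ) : 0 ≤ M.weight P x := by
  have h1 := hM.eta_nonneg
  have h2 := sub_pos.2 hM.discount_lt_one
  unfold weight
  positivity

theorem memLp_effectiveRisk (hM : M.IsStationaryModel P p) {v : ℝ → ℝ} (hvm : Measurable v)
    {c : ℝ} (hc : 0 ≤ c) (hv : ∀ x, |v x| ≤ c * M.weight P x) (x : ℝ) (f : RetainedLoss) :
    MemLp (M.effectiveRisk v x f) p P :=
  hM.memLp_of_abs_le (hM.measurable_effectiveRisk hvm x f)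
    ((hM.abs_effectiveRisk_le hc hv).mono fun _ hω => hω x f)

theorem coe_costOp (hM : M.IsStationaryModel P p) {v : ℝ → ℝ} (hvm : Measurable v)
    {c : ℝ} (hc : 0 ≤ c) (hv : ∀ x, |v x| ≤ c * M.weight P x) (x : ℝ) (f : RetainedLoss) :
    ((M.costOp v x f).toReal : EReal) = M.costOp v x f := by
  have hβ := hM.discount_pos
  have hβ1 := sub_pos.2 hM.discount_lt_one
  exact hM.coe_risk (hM.memLp_effectiveRisk hvm hc hv x f) (by positivity)
    ((hM.abs_effectiveRisk_le hc hv).mono fun _ hω => hω x f)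

theorem isMeaningful (hM : M.IsStationaryModel P p) {v : ℝ → ℝ} (hvm : Measurable v)
    {c : ℝ} (hc : 0 ≤ c) (hv : ∀ x, |v x| ≤ c * M.weight P x) (x : ℝ) (f : RetainedLoss) :
    M.IsMeaningful P p v x f := by
  refine ⟨hM.memLp_effectiveRisk hvm hc hv x f, ?_, ?_⟩
  · rw [← hM.coe_costOp hvm hc hv]
    exact EReal.coe_ne_bot _
  · rw [← hM.coe_costOp hvm hc hv]
    exact EReal.coe_ne_top _

theorem abs_costOp_le (hM : M.IsStationaryModel P p) {v : ℝ → ℝ} (hvm : Measurable v)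
    {c : ℝ} (hc : 0 ≤ c) (hv : ∀ x, |v x| ≤ c * M.weight P x) (x : ℝ) (f : RetainedLoss) :
    |(M.costOp v x f).toReal| ≤
      (1 + M.discount * c / (1 - M.discount) + M.discount * c) * M.weight P x := by
  have hβ := hM.discount_pos
  have hβ1 := sub_pos.2 hM.discount_lt_one
  have hη := hM.eta_nonneg
  have h0 := hM.risk_zero
  have hbound := hM.abs_toReal_risk_sub_le (X' := fun _ => 0)
    (hM.memLp_effectiveRisk hvm hc hv x f) MemLp.zero
    (hM.coe_costOp hvm hc hv x f) (by rw [h0, EReal.toReal_zero, EReal.coe_zero])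
    (show 0 ≤ 1 + M.discount * c / (1 - M.discount) by positivity)
    ((hM.abs_effectiveRisk_le hc hv).mono fun ω hω => by simpa only [sub_zero] using hω x f)
  rw [h0, EReal.toReal_zero, sub_zero] at hbound
  -- The weight dominates `|x| + η` and `η / (1 - β)²`.
  have hw1 : |x| + M.eta P ≤ M.weight P x := by
    unfold weight
    gcongr
    · exact le_div_self (abs_nonneg x) hβ1 (by linarith)
    · exact le_div_self hη (by positivity) (pow_le_one₀ hβ1.le (by linarith))
  have hw2 : M.eta P / (1 - M.discount) ^ 2 ≤ M.weight P x := by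
    unfold weight
    exact le_add_of_nonneg_left (by positivity)
  refine hbound.trans ?_
  calc
    _ = (1 + M.discount * c / (1 - M.discount)) * (|x| + M.eta P)
        + M.discount * c * (M.eta P / (1 - M.discount) ^ 2) := by
      unfold eta
      ring
    _ ≤ (1 + M.discount * c / (1 - M.discount)) * M.weight P x
        + M.discount * c * M.weight P x := by gcongr
    _ = _ := by ring

/-- The weighted Lipschitz estimate behind the contraction property: the discounted risk of the
weight of the next state is at most `1 - (1 - β)²` times the weight of the present state. -/
theorem abs_costOp_sub_le (hM : M.IsStationaryModel P p) {v w : ℝ → ℝ} (hvm : Measurable v)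
    {cv : ℝ} (hcv : 0 ≤ cv) (hv : ∀ x, |v x| ≤ cv * M.weight P x) (hwm : Measurable w)
    {cw : ℝ} (hcw : 0 ≤ cw) (hw : ∀ x, |w x| ≤ cw * M.weight P x) {c : ℝ} (hc : 0 ≤ c)
    (hvw : ∀ x, |v x - w x| ≤ c * M.weight P x) (x : ℝ) (f : RetainedLoss) :
    |(M.costOp v x f).toReal - (M.costOp w x f).toReal| ≤
      (1 - (1 - M.discount) ^ 2) * c * M.weight P x := by
  have hβ := hM.discount_pos
  have hβ1 := sub_pos.2 hM.discount_lt_one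
  have hη := hM.eta_nonneg
  have hbound := hM.abs_toReal_risk_sub_le (hM.memLp_effectiveRisk hvm hcv hv x f)
    (hM.memLp_effectiveRisk hwm hcw hw x f) (hM.coe_costOp hvm hcv hv x f)
    (hM.coe_costOp hwm hcw hw x f)
    (a := M.discount * c / (1 - M.discount))
    (c := M.discount * c / (1 - M.discount) *
          (|x| + (M.premium fun ω => (M.claim ω : ℝ)).toReal
            + essSup (fun ω => (M.income ω : ℝ)) P)
          + M.discount * c * (M.eta P / (1 - M.discount) ^ 2)) (by positivity) ?_
  · refine hbound.trans ?_
    have hx : 0 ≤ c * M.discount * |x| := by positivity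
    have hβ1' : 1 - M.discount ≠ 0 := hβ1.ne'
    calc
      _ = M.discount * c / (1 - M.discount) * (|x| + M.eta P)
          + M.discount * c * (M.eta P / (1 - M.discount) ^ 2) := by
        unfold eta
        ring
      _ = (1 - (1 - M.discount) ^ 2) * c * M.weight P x - c * M.discount * |x| := by
        unfold weight
        field_simp
        ring
      _ ≤ _ := sub_le_self _ hx
  · filter_upwards [hM.abs_nextState_le] with ω hω
    rw [effectiveRisk_eq, effectiveRisk_eq]
    set s := M.nextState x f ω with hs
    calc
      |-s + M.discount * v s - (-s + M.discount * w s)| = M.discount * |v s - w s| := by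
          rw [← abs_of_pos hβ, ← abs_mul, abs_of_pos hβ]
          ring_nf
      _ ≤ M.discount * (c * M.weight P s) := by gcongr; exact hvw s
      _ = M.discount * c / (1 - M.discount) * |s|
          + M.discount * c * (M.eta P / (1 - M.discount) ^ 2) := by
        unfold weight
        ring
      _ ≤ M.discount * c / (1 - M.discount) * (M.claim ω +
            (|x| + (M.premium fun ω => (M.claim ω : ℝ)).toReal
              + essSup (fun ω => (M.income ω : ℝ)) P))
          + M.discount * c * (M.eta P / (1 - M.discount) ^ 2) := by
        gcongr
        exact hω x f
      _ = _ := by ring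

theorem costOp_mono (hM : M.IsStationaryModel P p) {v w : ℝ → ℝ} (hvm : Measurable v)
    {cv : ℝ} (hcv : 0 ≤ cv) (hv : ∀ x, |v x| ≤ cv * M.weight P x) (hwm : Measurable w)
    {cw : ℝ} (hcw : 0 ≤ cw) (hw : ∀ x, |w x| ≤ cw * M.weight P x) (hvw : ∀ x, v x ≤ w x)
    (x : ℝ) (f : RetainedLoss) : M.costOp v x f ≤ M.costOp w x f := by
  refine hM.risk_coherent.monotone _ (hM.memLp_effectiveRisk hvm hcv hv x f) _
    (hM.memLp_effectiveRisk hwm hcw hw x f) (Eventually.of_forall fun ω => ?_)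
  rw [effectiveRisk_eq, effectiveRisk_eq]
  have := mul_le_mul_of_nonneg_left (hvw (M.nextState x f ω)) hM.discount_pos.le
  linarith

theorem costOp_antitone (hM : M.IsStationaryModel P p) {v : ℝ → ℝ} (hva : Antitone v)
    {c : ℝ} (hc : 0 ≤ c) (hv : ∀ x, |v x| ≤ c * M.weight P x) (f : RetainedLoss) :
    Antitone fun x => M.costOp v x f := by
  intro x y hxy
  refine hM.risk_coherent.monotone _ (hM.memLp_effectiveRisk hva.measurable hc hv y f) _
    (hM.memLp_effectiveRisk hva.measurable hc hv x f) (Eventually.of_forall fun ω => ?_)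
  rw [effectiveRisk_eq, effectiveRisk_eq]
  have hs : M.nextState x f ω ≤ M.nextState y f ω := by
    unfold nextState
    linarith
  have := mul_le_mul_of_nonneg_left (hva hs) hM.discount_pos.le
  linarith

end IsStationaryModel

end Reinsurance.Model

/-! ### The Bellman operator -/

namespace Reinsurance.Model

section PenalizedCost

variable {Ω : Type*} {M : Model Ω}

variable (M) in
open Classical in
/-- The cost `L v (x, f)`, extended by `∞` to inadmissible actions. -/
noncomputable def penalizedCost (v : ℝ → ℝ) (q : ℝ × RetainedLoss) : EReal :=
  if q.2 ∈ M.admissible q.1 then M.costOp v q.1 q.2 else ⊤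

theorem penalizedCost_le_iff {v : ℝ → ℝ} {x : ℝ} {f : RetainedLoss} {c : EReal} (hc : c ≠ ⊤) :
    M.penalizedCost v (x, f) ≤ c ↔ f ∈ M.admissible x ∧ M.costOp v x f ≤ c := by
  by_cases h : f ∈ M.admissible x <;> simp [penalizedCost, h, hc]

theorem iInf_penalizedCost (v : ℝ → ℝ) (x : ℝ) :
    ⨅ f, M.penalizedCost v (x, f) = ⨅ f ∈ M.admissible x, M.costOp v x f := by
  congr 1
  ext f
  by_cases h : f ∈ M.admissible x <;> simp [penalizedCost, h]

end PenalizedCost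

variable {Ω : Type*} [MeasurableSpace Ω] {P : Measure Ω} {p : ℝ≥0∞} {M : Model Ω}

namespace IsStationaryModel

theorem reinsurancePremium_le_of_tendsto (hM : M.IsStationaryModel P p) {f : ℕ → RetainedLoss}
    {f' : RetainedLoss} (hf : Tendsto f atTop (𝓝 f')) {c : ℕ → ℝ} {c' : ℝ}
    (hc : Tendsto c atTop (𝓝 c')) (h : ∀ n, M.reinsurancePremium (f n) ≤ c n) :
    M.reinsurancePremium f' ≤ c' := by
  by_contra! hlt
  obtain ⟨z, hz1, hz2⟩ := EReal.lt_iff_exists_real_btwn.1 hlt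
  refine (EReal.coe_lt_coe_iff.1 hz1).not_ge (ge_of_tendsto hc ?_)
  filter_upwards [hf.eventually (hM.lowerSemicontinuous_reinsurancePremium f' z hz2)] with n hn
  exact (EReal.coe_lt_coe_iff.1 (hn.trans_le (h n))).le

variable [IsProbabilityMeasure P]

/-- The effective risk is an antitone lower semicontinuous function of the next state. Along a
convergent sequence of states and actions, it therefore has the effective risk of the limit as a
pointwise lower bound in the limit, although the premium may drop in the limit. Replacing the
effective risks by their minima with the effective risk of the limit gives a convergent sequence, to
which the Fatou property applies. -/
theorem costOp_le_of_tendsto (hM : M.IsStationaryModel P p) {v : ℝ → ℝ} (hv : v ∈ M.valueSpace P)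
    {x : ℕ → ℝ} {x' : ℝ} (hx : Tendsto x atTop (𝓝 x')) {f : ℕ → RetainedLoss} {f' : RetainedLoss}
    (hf : Tendsto f atTop (𝓝 f')) {c : EReal} (h : ∀ n, M.costOp v (x n) (f n) ≤ c) :
    M.costOp v x' f' ≤ c := by
  obtain ⟨hlsc, hanti, b, hb, hvb⟩ := hv
  have hβ := hM.discount_pos
  have hβ1 := sub_pos.2 hM.discount_lt_one
  -- The premiums converge along a subsequence, to a limit which is at least the premium of `f'`.
  obtain ⟨π', -, φ, hφ, hπ⟩ := tendsto_subseq_of_bounded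
    (Metric.isBounded_Icc (0 : ℝ) (M.premium fun ω => (M.claim ω : ℝ)).toReal)
    (fun n => ⟨hM.toReal_reinsurancePremium_nonneg (f n), hM.toReal_reinsurancePremium_le (f n)⟩)
  have hxφ := hx.comp hφ.tendsto_atTop
  have hfφ := hf.comp hφ.tendsto_atTop
  have hπ' : (M.reinsurancePremium f').toReal ≤ π' := by
    rw [← EReal.coe_le_coe_iff, hM.coe_reinsurancePremium]
    exact hM.reinsurancePremium_le_of_tendsto hfφ hπ fun n => (hM.coe_reinsurancePremium _).ge
  set g : ℝ → ℝ := fun s => -s + M.discount * v s with hg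
  have hglsc : LowerSemicontinuous g :=
    continuous_neg.lowerSemicontinuous.add
      ((continuous_const_mul M.discount).comp_lowerSemicontinuous hlsc
        (monotone_mul_left_of_nonneg hβ.le))
  have hganti : Antitone g := fun s t hst => by
    have := mul_le_mul_of_nonneg_left (hanti hst) hβ.le
    simp only [hg]
    linarith
  obtain ⟨R, hR⟩ := hxφ.abs.bddAbove_range
  have hxR (n : ℕ) : |x (φ n)| ≤ R := hR ⟨n, rfl⟩
  have hx'R : |x'| ≤ R := le_of_tendsto' hxφ.abs hxR
  set A := 1 + M.discount * b / (1 - M.discount) with hA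
  have hA0 : 0 ≤ A := by positivity
  set κ := (M.premium fun ω => (M.claim ω : ℝ)).toReal
  set ζ := essSup (fun ω => (M.income ω : ℝ)) P
  set e := M.discount * b * (M.eta P / (1 - M.discount) ^ 2)
  have hbound : ∀ᵐ ω ∂P, ∀ y, |y| ≤ R → ∀ k, |M.effectiveRisk v y k ω| ≤
      A * M.claim ω + (A * (R + κ + ζ) + e) := by
    filter_upwards [hM.abs_effectiveRisk_le hb hvb] with ω hω y hy k
    refine (hω y k).trans ?_
    gcongr
  have hdom (n : ℕ) : ∀ᵐ ω ∂P,
      |min (M.effectiveRisk v (x (φ n)) (f (φ n)) ω) (M.effectiveRisk v x' f' ω)| ≤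
        A * M.claim ω + (A * (R + κ + ζ) + e) := by
    filter_upwards [hbound] with ω hω
    exact abs_min_le_max_abs_abs.trans (max_le (hω _ (hxR n) _) (hω _ hx'R _))
  have hmem (n : ℕ) : MemLp
      (fun ω => min (M.effectiveRisk v (x (φ n)) (f (φ n)) ω) (M.effectiveRisk v x' f' ω)) p P :=
    hM.memLp_of_abs_le ((hM.measurable_effectiveRisk hanti.measurable _ _).min
      (hM.measurable_effectiveRisk hanti.measurable _ _)) (hdom n)
  refine hM.risk_fatou.le_of_tendsto hmem
    (hM.memLp_effectiveRisk hanti.measurable hb hvb x' f') (hM.memLp_affine_claim _ _) hdom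
    (Eventually.of_forall fun ω => ?_) fun n => ?_
  · have hs : Tendsto (fun n => M.nextState (x (φ n)) (f (φ n)) ω) atTop
        (𝓝 (x' + M.income ω - f' (M.claim ω) - π')) :=
      ((hxφ.add_const _).sub (((RetainedLoss.continuous_apply _).tendsto f').comp hfφ)).sub hπ
    have hle : M.effectiveRisk v x' f' ω ≤ g (x' + M.income ω - f' (M.claim ω) - π') := by
      rw [effectiveRisk_eq]
      refine hganti ?_
      unfold nextState
      linarith
    refine tendsto_order.2 ⟨fun a ha => ?_, fun a ha =>
      Eventually.of_forall fun n => (min_le_right _ _).trans_lt ha⟩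
    filter_upwards [hs.eventually (hglsc _ a (ha.trans_le hle))] with n hn
    refine lt_min ?_ ha
    rwa [effectiveRisk_eq]
  · refine le_trans ?_ (h (φ n))
    exact hM.risk_coherent.monotone _ (hmem n) _
      (hM.memLp_effectiveRisk hanti.measurable hb hvb _ _)
      (Eventually.of_forall fun ω => min_le_left _ _)

theorem lowerSemicontinuous_penalizedCost (hM : M.IsStationaryModel P p) {v : ℝ → ℝ}
    (hv : v ∈ M.valueSpace P) : LowerSemicontinuous (M.penalizedCost v) := by
  refine lowerSemicontinuous_iff_isClosed_preimage.2 fun c =>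
    IsSeqClosed.isClosed fun q q' hq hlim => ?_
  rcases eq_or_ne c ⊤ with rfl | hc
  · exact (le_top : M.penalizedCost v q' ≤ ⊤)
  have hx := (continuous_fst.tendsto q').comp hlim
  have hf := (continuous_snd.tendsto q').comp hlim
  have hq' (n : ℕ) := (penalizedCost_le_iff hc).1 (hq n)
  refine (penalizedCost_le_iff hc).2 ⟨fun hbudget => ?_,
    hM.costOp_le_of_tendsto hv hx hf fun n => (hq' n).2⟩
  exact hM.reinsurancePremium_le_of_tendsto hf (hx.max tendsto_const_nhds)
    fun n => (hq' n).1 hbudget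

theorem exists_minimizing_rule (hM : M.IsStationaryModel P p) {v : ℝ → ℝ}
    (hv : v ∈ M.valueSpace P) :
    ∃ d : M.MarkovRule, ∀ x, M.costOp v x (d.toFun x) = ⨅ f ∈ M.admissible x, M.costOp v x f := by
  obtain ⟨hlsc, hanti, b, hb, hvb⟩ := id hv
  obtain ⟨d, hd, hmin⟩ := exists_measurable_minimizer (hM.lowerSemicontinuous_penalizedCost hv)
    (fun n => RetainedLoss.continuous_apply (TopologicalSpace.denseSeq ℝ≥0 n))
    RetainedLoss.eq_of_eq_on_denseSeq
  have hfin (x : ℝ) : ⨅ f ∈ M.admissible x, M.costOp v x f ≠ ⊤ :=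
    ((iInf₂_le _ (hM.full_mem_admissible x)).trans_lt
      (hM.isMeaningful hanti.measurable hb hvb x _).2.2.lt_top).ne
  have hd' (x : ℝ) := (penalizedCost_le_iff (hfin x)).1
    ((hmin x).trans (iInf_penalizedCost v x)).le
  exact ⟨⟨d, hd, fun x => (hd' x).1⟩, fun x => le_antisymm (hd' x).2 (iInf₂_le _ (hd' x).1)⟩

theorem coe_bellmanOp (hM : M.IsStationaryModel P p) {v : ℝ → ℝ} (hv : v ∈ M.valueSpace P) (x : ℝ) :
    (M.bellmanOp v x : EReal) = ⨅ f ∈ M.admissible x, M.costOp v x f := by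
  obtain ⟨d, hd⟩ := hM.exists_minimizing_rule hv
  obtain ⟨-, hanti, b, hb, hvb⟩ := hv
  rw [bellmanOp, ← hd]
  exact hM.coe_costOp hanti.measurable hb hvb x _

theorem exists_ruleOp_eq_bellmanOp (hM : M.IsStationaryModel P p) {v : ℝ → ℝ}
    (hv : v ∈ M.valueSpace P) : ∃ d : M.MarkovRule, M.ruleOp d v = M.bellmanOp v := by
  obtain ⟨d, hd⟩ := hM.exists_minimizing_rule hv
  exact ⟨d, funext fun x => by rw [ruleOp, hd, bellmanOp]⟩

theorem bellmanOp_le (hM : M.IsStationaryModel P p) {v : ℝ → ℝ} (hv : v ∈ M.valueSpace P) {x : ℝ}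
    {f : RetainedLoss} (hf : f ∈ M.admissible x) : M.bellmanOp v x ≤ (M.costOp v x f).toReal := by
  rw [← EReal.coe_le_coe_iff, hM.coe_bellmanOp hv]
  obtain ⟨-, hanti, b, hb, hvb⟩ := hv
  rw [hM.coe_costOp hanti.measurable hb hvb]
  exact iInf₂_le f hf

theorem bellmanOp_mem (hM : M.IsStationaryModel P p) {v : ℝ → ℝ} (hv : v ∈ M.valueSpace P) :
    M.bellmanOp v ∈ M.valueSpace P := by
  have hcoe := funext (hM.coe_bellmanOp hv)
  have hβ := hM.discount_pos
  have hβ1 := sub_pos.2 hM.discount_lt_one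
  refine ⟨?_, ?_, ?_⟩
  · have hlsc := lowerSemicontinuous_biInf (hM.lowerSemicontinuous_penalizedCost hv) isClosed_univ
    simp only [Set.mem_univ, iInf_pos, iInf_penalizedCost] at hlsc
    rw [← hcoe] at hlsc
    intro x y hy
    filter_upwards [hlsc x y (EReal.coe_lt_coe_iff.2 hy)] with z hz
    exact EReal.coe_lt_coe_iff.1 hz
  · intro x y hxy
    rw [← EReal.coe_le_coe_iff, hM.coe_bellmanOp hv, hM.coe_bellmanOp hv]
    obtain ⟨-, hanti, b, hb, hvb⟩ := hv
    refine le_iInf₂ fun f hf => (iInf₂_le f fun hbudget => ?_).trans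
      (hM.costOp_antitone hanti hb hvb f hxy)
    exact (hf hbudget).trans (EReal.coe_le_coe_iff.2 (max_le_max_right 0 hxy))
  · obtain ⟨d, hd⟩ := hM.exists_ruleOp_eq_bellmanOp hv
    obtain ⟨-, hanti, b, hb, hvb⟩ := hv
    rw [← hd]
    exact ⟨_, by positivity, fun x => hM.abs_costOp_le hanti.measurable hb hvb x _⟩

theorem bellmanOp_le_add (hM : M.IsStationaryModel P p) {v w : ℝ → ℝ} (hv : v ∈ M.valueSpace P)
    (hw : w ∈ M.valueSpace P) {c : ℝ} (hc : 0 ≤ c) (hvw : ∀ x, |v x - w x| ≤ c * M.weight P x)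
    (x : ℝ) : M.bellmanOp v x ≤
      M.bellmanOp w x + (1 - (1 - M.discount) ^ 2) * c * M.weight P x := by
  obtain ⟨d, hd⟩ := hM.exists_ruleOp_eq_bellmanOp hw
  have h1 := hM.bellmanOp_le hv (d.admissible x)
  obtain ⟨-, hva, bv, hbv, hvb⟩ := hv
  obtain ⟨-, hwa, bw, hbw, hwb⟩ := hw
  have h2 := hM.abs_costOp_sub_le hva.measurable hbv hvb hwa.measurable hbw hwb hc hvw x
    (d.toFun x)
  rw [← hd, ruleOp]
  linarith [(abs_le.1 h2).2]

theorem abs_bellmanOp_sub_le (hM : M.IsStationaryModel P p) {v w : ℝ → ℝ}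
    (hv : v ∈ M.valueSpace P) (hw : w ∈ M.valueSpace P) {c : ℝ} (hc : 0 ≤ c)
    (hvw : ∀ x, |v x - w x| ≤ c * M.weight P x) (x : ℝ) :
    |M.bellmanOp v x - M.bellmanOp w x| ≤ (1 - (1 - M.discount) ^ 2) * c * M.weight P x := by
  rw [abs_sub_le_iff]
  constructor
  · linarith [hM.bellmanOp_le_add hv hw hc hvw x]
  · linarith [hM.bellmanOp_le_add hw hv hc (fun y => abs_sub_comm (v y) (w y) ▸ hvw y) x]

theorem measurable_costOp_rule (hM : M.IsStationaryModel P p) (d : M.MarkovRule) {v : ℝ → ℝ}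
    (hvm : Measurable v) {c : ℝ} (hc : 0 ≤ c) (hv : ∀ x, |v x| ≤ c * M.weight P x) :
    Measurable fun x => M.costOp v x (d.toFun x) := by
  have : Fact (1 ≤ p) := ⟨hM.one_le_p⟩
  have hπ : Measurable fun x => (M.reinsurancePremium (d.toFun x)).toReal :=
    (hM.lowerSemicontinuous_reinsurancePremium.measurable.comp d.measurable).ereal_toReal
  have hf : Measurable fun q : ℝ × ℝ≥0 × ℝ≥0 => (d.toFun q.1 q.2.1 : ℝ) := by
    have h : Measurable (Function.uncurry fun (t : ℝ≥0) (x : ℝ) => (d.toFun x t : ℝ)) :=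
      measurable_uncurry_of_continuous_of_measurable
        (fun x => (d.toFun x).lipschitz.continuous)
        fun t => (RetainedLoss.continuous_apply t).measurable.comp d.measurable
    exact h.comp ((measurable_fst.comp measurable_snd).prodMk measurable_fst)
  have hG : Measurable fun q : ℝ × ℝ≥0 × ℝ≥0 =>
      (d.toFun q.1 q.2.1 : ℝ) + (M.reinsurancePremium (d.toFun q.1)).toReal - q.2.2 - q.1
        + M.discount * v (q.1 + q.2.2 - d.toFun q.1 q.2.1
          - (M.reinsurancePremium (d.toFun q.1)).toReal) := by
    have hπ' : Measurable fun q : ℝ × ℝ≥0 × ℝ≥0 => (M.reinsurancePremium (d.toFun q.1)).toReal :=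
      hπ.comp measurable_fst
    fun_prop
  exact hM.risk_fatou.measurable_param hM.p_ne_top
    (hM.measurable_claim.prodMk hM.measurable_income) hG
    fun x => hM.memLp_effectiveRisk hvm hc hv x (d.toFun x)

theorem measurable_ruleOp (hM : M.IsStationaryModel P p) (d : M.MarkovRule) {v : ℝ → ℝ}
    (hvm : Measurable v) {c : ℝ} (hc : 0 ≤ c) (hv : ∀ x, |v x| ≤ c * M.weight P x) :
    Measurable (M.ruleOp d v) :=
  (hM.measurable_costOp_rule d hvm hc hv).ereal_toReal

end IsStationaryModel

end Reinsurance.Model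

/-! ### Value iteration -/

namespace Reinsurance.Model

variable {Ω : Type*} [MeasurableSpace Ω] {P : Measure Ω} {p : ℝ≥0∞} {M : Model Ω}

variable (M) in
/-- The value iterates `T^N 0`. -/
noncomputable def valueIterate (N : ℕ) : ℝ → ℝ := M.bellmanOp^[N] 0

theorem valueIterate_succ {Ω : Type*} (M : Model Ω) (N : ℕ) :
    M.valueIterate (N + 1) = M.bellmanOp (M.valueIterate N) :=
  Function.iterate_succ_apply' _ _ _

theorem zero_mem_valueSpace : (0 : ℝ → ℝ) ∈ M.valueSpace P :=
  ⟨lowerSemicontinuous_const, antitone_const, 0, le_rfl, fun x => by simp⟩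

theorem continuous_weight : Continuous (M.weight P) := by
  unfold weight
  fun_prop

namespace IsStationaryModel

theorem modulus_pos (hM : M.IsStationaryModel P p) : 0 < 1 - (1 - M.discount) ^ 2 := by
  nlinarith [hM.discount_pos, hM.discount_lt_one]

theorem modulus_lt_one (hM : M.IsStationaryModel P p) : 1 - (1 - M.discount) ^ 2 < 1 := by
  nlinarith [hM.discount_pos, hM.discount_lt_one]

theorem tendsto_modulus_pow_mul (hM : M.IsStationaryModel P p) (c : ℝ) :
    Tendsto (fun N => (1 - (1 - M.discount) ^ 2) ^ N * c) atTop (𝓝 0) := by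
  simpa using (tendsto_pow_atTop_nhds_zero_of_lt_one hM.modulus_pos.le hM.modulus_lt_one).mul_const c

variable [IsProbabilityMeasure P]

theorem valueIterate_mem (hM : M.IsStationaryModel P p) (N : ℕ) :
    M.valueIterate N ∈ M.valueSpace P := by
  induction N with
  | zero => exact zero_mem_valueSpace
  | succ N ih =>
    rw [valueIterate_succ]
    exact hM.bellmanOp_mem ih

theorem abs_ruleOp_zero_le (hM : M.IsStationaryModel P p) (d : M.MarkovRule) (x : ℝ) :
    |M.ruleOp d (fun _ => 0) x| ≤ M.weight P x := by
  simpa [ruleOp] using hM.abs_costOp_le (v := fun _ => 0) measurable_const le_rfl (fun x => by simp) x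
    (d.toFun x)

theorem policyValue_bound (hM : M.IsStationaryModel P p) (N : ℕ) (π : M.MarkovPolicy) :
    Measurable (M.policyValue N π) ∧
      ∃ c : ℝ, 0 ≤ c ∧ ∀ x, |M.policyValue N π x| ≤ c * M.weight P x := by
  have hβ := hM.discount_pos
  have hβ1 := sub_pos.2 hM.discount_lt_one
  induction N generalizing π with
  | zero => exact ⟨measurable_const, 0, le_rfl, fun x => by simp [policyValue]⟩
  | succ N ih =>
    obtain ⟨hm, c, hc, hb⟩ := ih fun n => π (n + 1)
    exact ⟨hM.measurable_ruleOp _ hm hc hb, _, by positivity,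
      fun x => hM.abs_costOp_le hm hc hb x _⟩

theorem abs_policyValue_succ_sub_le (hM : M.IsStationaryModel P p) (N : ℕ) (π : M.MarkovPolicy)
    (x : ℝ) : |M.policyValue (N + 1) π x - M.policyValue N π x| ≤
      (1 - (1 - M.discount) ^ 2) ^ N * M.weight P x := by
  induction N generalizing π x with
  | zero => simpa [policyValue] using hM.abs_ruleOp_zero_le (π 0) x
  | succ N ih =>
    obtain ⟨hm, c, hc, hb⟩ := hM.policyValue_bound (N + 1) fun n => π (n + 1)
    obtain ⟨hm', c', hc', hb'⟩ := hM.policyValue_bound N fun n => π (n + 1)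
    rw [pow_succ']
    exact hM.abs_costOp_sub_le hm hc hb hm' hc' hb' (pow_nonneg hM.modulus_pos.le N)
      (ih fun n => π (n + 1)) x _

theorem tendsto_policyValue (hM : M.IsStationaryModel P p) (π : M.MarkovPolicy) (x : ℝ) :
    Tendsto (fun N => M.policyValue N π x) atTop (𝓝 (M.policyValueInfinite π x)) :=
  (cauchySeq_of_le_geometric _ (M.weight P x) hM.modulus_lt_one fun N => by
    rw [dist_comm, Real.dist_eq, mul_comm]
    exact hM.abs_policyValue_succ_sub_le N π x).tendsto_limUnder

theorem valueIterate_le_policyValue (hM : M.IsStationaryModel P p) (N : ℕ) (π : M.MarkovPolicy)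
    (x : ℝ) : M.valueIterate N x ≤ M.policyValue N π x := by
  induction N generalizing π x with
  | zero => exact le_rfl
  | succ N ih =>
    obtain ⟨hm, c, hc, hb⟩ := hM.policyValue_bound N fun n => π (n + 1)
    have hmem := hM.valueIterate_mem N
    rw [valueIterate_succ]
    refine (hM.bellmanOp_le hmem ((π 0).admissible x)).trans ?_
    obtain ⟨-, hanti, c', hc', hb'⟩ := hmem
    rw [← EReal.coe_le_coe_iff, hM.coe_costOp hanti.measurable hc' hb', policyValue, ruleOp,
      hM.coe_costOp hm hc hb]
    exact hM.costOp_mono hanti.measurable hc' hb' hm hc hb (ih _) x _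

theorem exists_policyValue_eq_valueIterate (hM : M.IsStationaryModel P p) (N : ℕ) :
    ∃ π : M.MarkovPolicy, M.policyValue N π = M.valueIterate N := by
  induction N with
  | zero =>
    obtain ⟨d, -⟩ := hM.exists_minimizing_rule zero_mem_valueSpace
    exact ⟨d.stationary, rfl⟩
  | succ N ih =>
    obtain ⟨π, hπ⟩ := ih
    obtain ⟨d, hd⟩ := hM.exists_ruleOp_eq_bellmanOp (hM.valueIterate_mem N)
    refine ⟨fun n => Nat.casesOn n d π, ?_⟩
    rw [valueIterate_succ, ← hd, ← hπ]
    rfl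

theorem isLeast_valueIterate (hM : M.IsStationaryModel P p) (N : ℕ) (x : ℝ) :
    IsLeast (Set.range fun π : M.MarkovPolicy => M.policyValue N π x) (M.valueIterate N x) := by
  obtain ⟨π, hπ⟩ := hM.exists_policyValue_eq_valueIterate N
  refine ⟨⟨π, congrFun hπ x⟩, ?_⟩
  rintro _ ⟨π, rfl⟩
  exact hM.valueIterate_le_policyValue N π x

theorem valueFunction_eq (hM : M.IsStationaryModel P p) (N : ℕ) :
    M.valueFunction N = M.valueIterate N :=
  funext fun x => (hM.isLeast_valueIterate N x).csInf_eq

theorem abs_valueIterate_succ_sub_le (hM : M.IsStationaryModel P p) (N : ℕ) (x : ℝ) :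
    |M.valueIterate (N + 1) x - M.valueIterate N x| ≤
      (1 - (1 - M.discount) ^ 2) ^ N * M.weight P x := by
  induction N generalizing x with
  | zero =>
    obtain ⟨d, hd⟩ := hM.exists_ruleOp_eq_bellmanOp zero_mem_valueSpace
    have h : |M.ruleOp d 0 x| ≤ M.weight P x := hM.abs_ruleOp_zero_le d x
    rw [hd] at h
    simpa [valueIterate] using h
  | succ N ih =>
    rw [valueIterate_succ M (N + 1), valueIterate_succ M N, pow_succ']
    rw [valueIterate_succ M N] at ih
    exact hM.abs_bellmanOp_sub_le (hM.bellmanOp_mem (hM.valueIterate_mem N))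
      (hM.valueIterate_mem N) (pow_nonneg hM.modulus_pos.le N) ih x

theorem dist_valueIterate_le (hM : M.IsStationaryModel P p) (x : ℝ) (N : ℕ) :
    dist (M.valueIterate N x) (M.valueIterate (N + 1) x) ≤
      M.weight P x * (1 - (1 - M.discount) ^ 2) ^ N := by
  rw [dist_comm, Real.dist_eq, mul_comm]
  exact hM.abs_valueIterate_succ_sub_le N x

theorem tendsto_valueIterate (hM : M.IsStationaryModel P p) (x : ℝ) :
    Tendsto (fun N => M.valueIterate N x) atTop (𝓝 (M.limitValueFunction x)) := by
  have h : limUnder atTop (fun N => M.valueIterate N x) = M.limitValueFunction x := by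
    simp only [limitValueFunction, hM.valueFunction_eq]
  rw [← h]
  exact (cauchySeq_of_le_geometric _ _ hM.modulus_lt_one
    (hM.dist_valueIterate_le x)).tendsto_limUnder

theorem abs_valueIterate_sub_limit_le (hM : M.IsStationaryModel P p) (N : ℕ) (x : ℝ) :
    |M.valueIterate N x - M.limitValueFunction x| ≤
      (1 - (1 - M.discount) ^ 2) ^ N * ((1 - M.discount) ^ 2)⁻¹ * M.weight P x := by
  have h := dist_le_of_le_geometric_of_tendsto _ _ hM.modulus_lt_one (hM.dist_valueIterate_le x)
    (hM.tendsto_valueIterate x) N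
  rw [Real.dist_eq] at h
  refine h.trans_eq ?_
  rw [sub_sub_cancel]
  ring

/-- Lower semicontinuity survives in the limit since the value iterates, lowered by their
distance to the limit, increase to it from below. -/
theorem limitValueFunction_mem (hM : M.IsStationaryModel P p) :
    M.limitValueFunction ∈ M.valueSpace P := by
  refine ⟨fun x y hy => ?_, fun x y hxy => ?_, ((1 - M.discount) ^ 2)⁻¹, by positivity,
    fun x => ?_⟩
  · have hlim : Tendsto (fun N => M.valueIterate N x -
        (1 - (1 - M.discount) ^ 2) ^ N * (((1 - M.discount) ^ 2)⁻¹ * M.weight P x)) atTop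
        (𝓝 (M.limitValueFunction x)) := by
      simpa using (hM.tendsto_valueIterate x).sub (hM.tendsto_modulus_pow_mul _)
    obtain ⟨N, hN⟩ := (hlim.eventually_const_lt hy).exists
    have hcont : Continuous fun z => -((1 - (1 - M.discount) ^ 2) ^ N *
        (((1 - M.discount) ^ 2)⁻¹ * M.weight P z)) := by
      have := continuous_weight (M := M) (P := P)
      fun_prop
    have hlsc := (hM.valueIterate_mem N).1.add hcont.lowerSemicontinuous
    filter_upwards [hlsc x y (by simpa [sub_eq_add_neg] using hN)] with z hz
    have := (abs_le.1 (hM.abs_valueIterate_sub_limit_le N z)).2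
    linarith
  · exact le_of_tendsto_of_tendsto' (hM.tendsto_valueIterate y) (hM.tendsto_valueIterate x)
      fun N => (hM.valueIterate_mem N).2.1 hxy
  · simpa [valueIterate] using hM.abs_valueIterate_sub_limit_le 0 x

theorem eq_limitValueFunction_of_abs_sub_le (hM : M.IsStationaryModel P p) {y x c : ℝ}
    (h : ∀ N, |y - M.valueIterate N x| ≤ (1 - (1 - M.discount) ^ 2) ^ N * c) :
    y = M.limitValueFunction x := by
  refine tendsto_nhds_unique ?_ (hM.tendsto_valueIterate x)
  refine tendsto_iff_dist_tendsto_zero.2 (squeeze_zero (fun _ => dist_nonneg) (fun N => ?_)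
    (hM.tendsto_modulus_pow_mul c))
  rw [dist_comm, Real.dist_eq]
  exact h N

theorem bellmanOp_limitValueFunction (hM : M.IsStationaryModel P p) :
    M.bellmanOp M.limitValueFunction = M.limitValueFunction := by
  funext x
  refine tendsto_nhds_unique (f := fun N => M.valueIterate (N + 1) x) ?_
    ((tendsto_add_atTop_iff_nat 1).2 (hM.tendsto_valueIterate x))
  refine tendsto_iff_dist_tendsto_zero.2 (squeeze_zero (fun _ => dist_nonneg) (fun N => ?_)
    (hM.tendsto_modulus_pow_mul
      ((1 - (1 - M.discount) ^ 2) * ((1 - M.discount) ^ 2)⁻¹ * M.weight P x)))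
  rw [Real.dist_eq, valueIterate_succ]
  refine (hM.abs_bellmanOp_sub_le (hM.valueIterate_mem N) hM.limitValueFunction_mem
    (mul_nonneg (pow_nonneg hM.modulus_pos.le N) (by positivity))
    (hM.abs_valueIterate_sub_limit_le N) x).trans_eq ?_
  ring

theorem eq_limitValueFunction_of_fixed (hM : M.IsStationaryModel P p) {v : ℝ → ℝ}
    (hv : v ∈ M.valueSpace P) (hfix : M.bellmanOp v = v) : v = M.limitValueFunction := by
  obtain ⟨-, -, c, hc, hb⟩ := id hv
  funext x
  refine hM.eq_limitValueFunction_of_abs_sub_le (c := c * M.weight P x) fun N => ?_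
  rw [← mul_assoc]
  induction N generalizing x with
  | zero => simpa [valueIterate] using hb x
  | succ N ih =>
    have h := hM.abs_bellmanOp_sub_le hv (hM.valueIterate_mem N)
      (mul_nonneg (pow_nonneg hM.modulus_pos.le N) hc) ih x
    rw [hfix, ← valueIterate_succ] at h
    rwa [pow_succ', mul_assoc (1 - (1 - M.discount) ^ 2)]

/-- The value of the stationary policy of a rule attaining the minimum in the Bellman equation. -/
theorem policyValueInfinite_stationary (hM : M.IsStationaryModel P p) {d : M.MarkovRule}
    (hd : ∀ x, M.ruleOp d M.limitValueFunction x = M.bellmanOp M.limitValueFunction x) (x : ℝ) :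
    M.policyValueInfinite d.stationary x = M.limitValueFunction x := by
  obtain ⟨-, hanti, c, hc, hb⟩ := hM.limitValueFunction_mem
  have hbound (N : ℕ) (x : ℝ) : |M.policyValue N d.stationary x - M.limitValueFunction x| ≤
      (1 - (1 - M.discount) ^ 2) ^ N * c * M.weight P x := by
    induction N generalizing x with
    | zero => simpa [policyValue] using hb x
    | succ N ih =>
      obtain ⟨hm', c', hc', hb'⟩ := hM.policyValue_bound N d.stationary
      have h := hM.abs_costOp_sub_le hm' hc' hb' hanti.measurable hc hb
        (mul_nonneg (pow_nonneg hM.modulus_pos.le N) hc) ih x (d.toFun x)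
      rw [pow_succ', mul_assoc (1 - (1 - M.discount) ^ 2)]
      have hJ : (M.costOp M.limitValueFunction x (d.toFun x)).toReal = M.limitValueFunction x :=
        (hd x).trans (congrFun hM.bellmanOp_limitValueFunction x)
      rwa [hJ] at h
  refine tendsto_nhds_unique (hM.tendsto_policyValue d.stationary x) ?_
  refine tendsto_iff_dist_tendsto_zero.2 (squeeze_zero (fun _ => dist_nonneg) (fun N => ?_)
    (hM.tendsto_modulus_pow_mul (c * M.weight P x)))
  rw [Real.dist_eq, ← mul_assoc]
  exact hbound N x

theorem exists_ruleOp_limitValueFunction (hM : M.IsStationaryModel P p) :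
    ∃ d : M.MarkovRule, ∀ x,
      M.ruleOp d M.limitValueFunction x = M.bellmanOp M.limitValueFunction x := by
  obtain ⟨d, hd⟩ := hM.exists_ruleOp_eq_bellmanOp hM.limitValueFunction_mem
  exact ⟨d, congrFun hd⟩

theorem isLeast_limitValueFunction (hM : M.IsStationaryModel P p) (x : ℝ) :
    IsLeast (Set.range fun π : M.MarkovPolicy => M.policyValueInfinite π x)
      (M.limitValueFunction x) := by
  obtain ⟨d, hd⟩ := hM.exists_ruleOp_limitValueFunction
  refine ⟨⟨d.stationary, hM.policyValueInfinite_stationary hd x⟩, ?_⟩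
  rintro _ ⟨π, rfl⟩
  exact le_of_tendsto_of_tendsto' (hM.tendsto_valueIterate x) (hM.tendsto_policyValue π x)
    fun N => hM.valueIterate_le_policyValue N π x

theorem valueFunctionInfinite_eq (hM : M.IsStationaryModel P p) :
    M.valueFunctionInfinite = M.limitValueFunction :=
  funext fun x => (hM.isLeast_limitValueFunction x).csInf_eq

/-! ### The weighted norm -/

/-- Where the weight vanishes, so do the functions under consideration: the convention `0 / 0 = 0`
in the weighted norm is harmless. -/
theorem abs_le_weightedNorm_mul (hM : M.IsStationaryModel P p) {u : ℝ → ℝ} {c : ℝ}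
    (hc : 0 ≤ c) (hu : ∀ x, |u x| ≤ c * M.weight P x) (x : ℝ) :
    |u x| ≤ M.weightedNorm P u * M.weight P x := by
  rcases (hM.weight_nonneg x).eq_or_lt with h0 | hpos
  · simpa [← h0] using hu x
  · rw [← div_le_iff₀ hpos]
    refine le_ciSup (f := fun x => |u x| / M.weight P x) ⟨c, ?_⟩ x
    rintro _ ⟨y, rfl⟩
    exact div_le_of_le_mul₀ (hM.weight_nonneg y) hc (hu y)

theorem weightedNorm_nonneg (hM : M.IsStationaryModel P p) (u : ℝ → ℝ) :
    0 ≤ M.weightedNorm P u :=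
  Real.iSup_nonneg fun x => div_nonneg (abs_nonneg _) (hM.weight_nonneg x)

theorem weightedNorm_bellmanOp_sub_le (hM : M.IsStationaryModel P p) {v w : ℝ → ℝ}
    (hv : v ∈ M.valueSpace P) (hw : w ∈ M.valueSpace P) :
    M.weightedNorm P (M.bellmanOp v - M.bellmanOp w) ≤
      (1 - (1 - M.discount) ^ 2) * M.weightedNorm P (v - w) := by
  obtain ⟨-, -, cv, hcv, hbv⟩ := id hv
  obtain ⟨-, -, cw, hcw, hbw⟩ := id hw
  have hvw := hM.abs_le_weightedNorm_mul (u := v - w) (add_nonneg hcv hcw) fun x => by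
    rw [add_mul]
    exact (abs_sub _ _).trans (add_le_add (hbv x) (hbw x))
  have hnn := hM.weightedNorm_nonneg (v - w)
  exact ciSup_le fun x => div_le_of_le_mul₀ (hM.weight_nonneg x)
    (mul_nonneg hM.modulus_pos.le hnn) (hM.abs_bellmanOp_sub_le hv hw hnn hvw x)

end IsStationaryModel

end Reinsurance.Model

theorem mainTheorem2 {Ω : Type*} [MeasurableSpace Ω] (P : MeasureTheory.Measure Ω)
    [MeasureTheory.IsProbabilityMeasure P] (p : ℝ≥0∞) (M : Reinsurance.Model Ω)
    (hM : M.IsStationaryModel P p) :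
    -- all objects below are well defined
    (∀ v ∈ M.valueSpace P, ∀ x,
      (∀ f ∈ M.admissible x, M.IsMeaningful P p v x f) ∧
      (M.bellmanOp v x : EReal) = ⨅ f ∈ M.admissible x, M.costOp v x f) ∧
    (∀ (N : ℕ) (π : M.MarkovPolicy) (d : M.MarkovRule) (x : ℝ),
      M.IsMeaningful P p (M.policyValue N π) x (d.toFun x)) ∧
    (∀ N x, IsGLB (Set.range fun π : M.MarkovPolicy => M.policyValue N π x)
      (M.valueFunction N x)) ∧
    (∀ (π : M.MarkovPolicy) (x : ℝ), Tendsto (fun N => M.policyValue N π x) atTop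
      (𝓝 (M.policyValueInfinite π x))) ∧
    (∀ x, IsGLB (Set.range fun π : M.MarkovPolicy => M.policyValueInfinite π x)
      (M.valueFunctionInfinite x)) ∧
    (∀ x, Tendsto (fun N => M.valueFunction N x) atTop (𝓝 (M.limitValueFunction x))) ∧
    -- the Bellman operator is a contraction
    (0 < 1 - (1 - M.discount) ^ 2 ∧ 1 - (1 - M.discount) ^ 2 < 1) ∧
    (∀ v ∈ M.valueSpace P, M.bellmanOp v ∈ M.valueSpace P) ∧
    (∀ v ∈ M.valueSpace P, ∀ w ∈ M.valueSpace P,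
      M.weightedNorm P (M.bellmanOp v - M.bellmanOp w)
        ≤ (1 - (1 - M.discount) ^ 2) * M.weightedNorm P (v - w)) ∧
    -- the limit value function is its unique fixed point
    M.limitValueFunction ∈ M.valueSpace P ∧
    M.bellmanOp M.limitValueFunction = M.limitValueFunction ∧
    (∀ v ∈ M.valueSpace P, M.bellmanOp v = v → v = M.limitValueFunction) ∧
    -- existence of a minimizing Markov decision rule
    (∃ d : M.MarkovRule, ∀ x,
      M.ruleOp d M.limitValueFunction x = M.bellmanOp M.limitValueFunction x) ∧
    -- optimality of every stationary policy given by a minimizing rule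
    (∀ d : M.MarkovRule,
      (∀ x, M.ruleOp d M.limitValueFunction x = M.bellmanOp M.limitValueFunction x) →
      ∀ x, M.policyValueInfinite d.stationary x = M.valueFunctionInfinite x) ∧
    M.valueFunctionInfinite = M.limitValueFunction := by
  refine ⟨fun v hv x => ⟨fun f _ => ?_, hM.coe_bellmanOp hv x⟩, fun N π d x => ?_, fun N x => ?_,
    hM.tendsto_policyValue, fun x => ?_, fun x => ?_, ⟨hM.modulus_pos, hM.modulus_lt_one⟩,
    fun v hv => hM.bellmanOp_mem hv, fun v hv w hw => hM.weightedNorm_bellmanOp_sub_le hv hw,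
    hM.limitValueFunction_mem, hM.bellmanOp_limitValueFunction,
    fun v hv hfix => hM.eq_limitValueFunction_of_fixed hv hfix,
    hM.exists_ruleOp_limitValueFunction, fun d hd x => ?_, hM.valueFunctionInfinite_eq⟩
  · obtain ⟨-, hanti, c, hc, hb⟩ := hv
    exact hM.isMeaningful hanti.measurable hc hb x f
  · obtain ⟨hm, c, hc, hb⟩ := hM.policyValue_bound N π
    exact hM.isMeaningful hm hc hb x _
  · rw [hM.valueFunction_eq]
    exact (hM.isLeast_valueIterate N x).isGLB
  · rw [hM.valueFunctionInfinite_eq]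
    exact (hM.isLeast_limitValueFunction x).isGLB
  · simpa only [hM.valueFunction_eq] using hM.tendsto_valueIterate x
  · rw [hM.policyValueInfinite_stationary hd, hM.valueFunctionInfinite_eq]
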